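/- Let $A=G\langle g\rangle$ be a finite group that is the product of a normal subgroup $G$ and a cyclic subgroup $\langle g\rangle$, and let $R$ be the soluble radical of $G$ (its largest soluble normal subgroup). Let $C_{\langle g\rangle}(G/R)$ be the subgroup of those elements of $\langle g\rangle$ that induce the trivial automorphism of $G/R$ by conjugation, and let $\bar g$ be the automorphism of $G/R$ induced by conjugation by $g$. Suppose that the following conditions hold: (1) $G$ is a minimal $g$-invariant subgroup covering $G/R$; that is, if $K\leq G$ is a subgroup with $K^g=K$ and $KR=G$, then $K=G$; (2) $G\cap\langle g\rangle\leq C_{\langle g\rangle}(G/R)$; (3) $G/R=S_1\times\dots\times S_r$ with $r\geq 1$ is a direct product of isomorphic nonabelian finite simple groups $S_i$, which are transitively permuted by $\bar g$; (4) for some prime $p$ the stabilizer of $S_1$ in $\langle\bar g\rangle$ is a $p$-group, possibly trivial. Then for every subgroup $H\leq G\langle g\rangle$ such that $G\not\leq H$ there is $z\in G$ such that $H^z\cap\langle g\rangle\leq C_{\langle g\rangle}(G/R)$, where $H^z=z^{-1}Hz$. -/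

import Mathlib

open scoped Pointwise

/-- The soluble radical of `G`: the subgroup generated by all soluble normal subgroups of `G`
(for finite `G` it is the largest soluble normal subgroup). -/
def solubleRadical (G : Type*) [Group G] : Subgroup G :=
  sSup {N : Subgroup G | N.Normal ∧ Group.IsSolvable N}

instance solubleRadical_characteristic (G : Type*) [Group G] :
    (solubleRadical G).Characteristic := by
  rw [Subgroup.characteristic_iff_map_le]
  intro φ
  rw [solubleRadical, (Subgroup.gc_map_comap φ.toMonoidHom).l_sSup]
  refine iSup₂_le fun N hN => le_sSup ⟨hN.1.map _ φ.surjective, ?_⟩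
  have := hN.2
  exact Group.isSolvable_of_surjective (φ.toMonoidHom.subgroupMap_surjective N)

/-- The automorphism of `G ⧸ N` induced by an automorphism of `G`, for `N` characteristic. -/
def quotientAut {G : Type*} [Group G] (N : Subgroup G) [N.Characteristic] :
    MulAut G →* MulAut (G ⧸ N) where
  toFun φ := QuotientGroup.congr N N φ (Subgroup.characteristic_iff_map_eq.mp ‹_› φ)
  map_one' := by
    ext x
    induction x using QuotientGroup.induction_on
    rfl
  map_mul' φ ψ := by
    ext x
    induction x using QuotientGroup.induction_on
    rfl

/-- The action of `A` by conjugation on `G/R`, where `G` is a normal subgroup of `A` and `R` is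
the soluble radical of `G`. -/
def conjModRadical {A : Type*} [Group A] (G : Subgroup A) [G.Normal] :
    A →* MulAut (G ⧸ solubleRadical G) :=
  (quotientAut (solubleRadical G)).comp MulAut.conjNormal

/-- The centralizer `C_{⟨g⟩}(G/R)`, where `R` is the soluble radical of `G`. -/
def centralizerModRadical {A : Type*} [Group A] (G : Subgroup A) [G.Normal] (g : A) :
    Subgroup A :=
  Subgroup.zpowers g ⊓ (conjModRadical G).ker

/-- `K ≤ G` is `g`-invariant: `gKg⁻¹ = K`. -/
def IsInvariantUnder {A : Type*} [Group A] (G : Subgroup A) [G.Normal] (g : A)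
    (K : Subgroup G) : Prop :=
  (MulAut.conjNormal g : MulAut G) • K = K

/-- `K ≤ G` covers `G/R`, where `R` is the soluble radical of `G`. -/
def CoversModRadical {G : Type*} [Group G] (K : Subgroup G) : Prop :=
  K.map (QuotientGroup.mk' (solubleRadical G)) = ⊤

/-- `Q` is the internal direct product of the family of subgroups `S`. -/
structure IsInternalDirectProduct {Q ι : Type*} [Group Q] (S : ι → Subgroup Q) : Prop where
  normal : ∀ i, (S i).Normal
  independent : iSupIndep S
  iSup_eq_top : ⨆ i, S i = ⊤

/-- `S` is a nonabelian simple group. -/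
def IsNonabelianSimple (S : Type*) [Group S] : Prop :=
  IsSimpleGroup S ∧ ∃ a b : S, a * b ≠ b * a

/-! Let `C` be the centralizer of `G/R` in `⟨g⟩`. There are elements `x q` of `⟨g⟩` of prime power
order, one for each prime `q` dividing `|⟨g⟩ : C|`, such that every `y ∈ ⟨g⟩` outside `C` has some
`x q` among its powers (`exists_primary_elements`). So it suffices to find a conjugate of `H` that
avoids all the `x q` at once. There are two cases.

If `HR` does not contain `G`, one works in `A/R`, where the image of `G` is a product of simple
groups, and inducts on its order (`IsFaithfulProjection.exists_conj_inf_zpowers_le`). If every `x q`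
preserves a simple factor, the stabilizer condition leaves only `q = p`, and a subgroup containing
all conjugates of `x p` contains `[G, x p] = G`. Otherwise some `x = x q` moves the factor, and `D =
C_G(x)` is again a product of copies of the same simple group, of smaller order. If no conjugate of
`H` is good, induction in `D` shows that every conjugate of `H` contains `x` or `D`. A commutator
computation (`factor_le_of_forall_conj`) then forces `G ≤ H`.

If `G ≤ HR`, conjugation by `R` is enough. A suitable section of `R` reduces the problem to an
elementary abelian `ℓ`-group, where the conjugators that bring `x q` into `H` form a coset of the
fixed points of `x q`, or the empty set. Such cosets for distinct primes do not cover the group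
(`exists_avoiding_fixedPoints`). Minimality of `G` guarantees that each single `x q` can be moved
out of `H`. -/

/-! ### Products of simple groups, described by one projection and its conjugates. -/

/-- `f` restricts to a surjective homomorphism from `G` onto `T`, the subgroup `G` is normalized
by `⟨g⟩`, and the `⟨g⟩`-conjugates of the kernel of this restriction intersect trivially. -/
structure IsFaithfulProjection {A T : Type*} [Group A] [Group T] (G : Subgroup A) (g : A)
    (f : A → T) : Prop where
  conj_mem : ∀ y ∈ Subgroup.zpowers g, ∀ a ∈ G, y * a * y⁻¹ ∈ G
  map_mul : ∀ a ∈ G, ∀ b ∈ G, f (a * b) = f a * f b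
  surj : ∀ t, ∃ a ∈ G, f a = t
  faithful : ∀ a ∈ G, (∀ y ∈ Subgroup.zpowers g, f (y * a * y⁻¹) = 1) → a = 1

namespace IsFaithfulProjection

variable {A T : Type*} [Group A] [Group T] {G : Subgroup A} {g : A} {f : A → T}

theorem map_one (h : IsFaithfulProjection G g f) : f 1 = 1 := by
  simpa using h.map_mul 1 G.one_mem 1 G.one_mem

theorem map_inv (h : IsFaithfulProjection G g f) {a : A} (ha : a ∈ G) : f a⁻¹ = (f a)⁻¹ := by
  rw [eq_inv_iff_mul_eq_one, ← h.map_mul _ (G.inv_mem ha) _ ha, inv_mul_cancel, h.map_one]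

theorem map_conj (h : IsFaithfulProjection G g f) {a b : A} (ha : a ∈ G) (hb : b ∈ G) :
    f (a * b * a⁻¹) = f a * f b * (f a)⁻¹ := by
  rw [h.map_mul _ (G.mul_mem ha hb) _ (G.inv_mem ha), h.map_mul _ ha _ hb, h.map_inv ha]

theorem map_conj_mul (h : IsFaithfulProjection G g f) {y a b : A}
    (hy : y ∈ Subgroup.zpowers g) (ha : a ∈ G) (hb : b ∈ G) :
    f (y * (a * b) * y⁻¹) = f (y * a * y⁻¹) * f (y * b * y⁻¹) := by
  rw [← h.map_mul _ (h.conj_mem y hy a ha) _ (h.conj_mem y hy b hb)]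
  congr 1
  group

theorem map_conj_inv (h : IsFaithfulProjection G g f) {y a : A}
    (hy : y ∈ Subgroup.zpowers g) (ha : a ∈ G) :
    f (y * a⁻¹ * y⁻¹) = (f (y * a * y⁻¹))⁻¹ := by
  rw [← h.map_inv (h.conj_mem y hy a ha)]
  congr 1
  group

/-- The elements of `G` whose conjugates by the elements of `Y ∩ ⟨g⟩` lie in the kernel. -/
def conjKernel (h : IsFaithfulProjection G g f) (Y : Set A) : Subgroup A where
  carrier := {s | s ∈ G ∧ ∀ y ∈ Y, y ∈ Subgroup.zpowers g → f (y * s * y⁻¹) = 1}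
  one_mem' := ⟨G.one_mem, fun y _ _ => by simpa using h.map_one⟩
  mul_mem' := fun ha hb => ⟨G.mul_mem ha.1 hb.1, fun y hy hyg => by
    rw [h.map_conj_mul hyg ha.1 hb.1, ha.2 y hy hyg, hb.2 y hy hyg, mul_one]⟩
  inv_mem' := fun ha => ⟨G.inv_mem ha.1, fun y hy hyg => by
    rw [h.map_conj_inv hyg ha.1, ha.2 y hy hyg, inv_one]⟩

theorem conj_mem_conjKernel (h : IsFaithfulProjection G g f) {Y : Set A} {a s : A} (ha : a ∈ G)
    (hs : s ∈ h.conjKernel Y) : a * s * a⁻¹ ∈ h.conjKernel Y := by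
  refine ⟨G.mul_mem (G.mul_mem ha hs.1) (G.inv_mem ha), fun y hy hyg => ?_⟩
  rw [h.map_conj_mul hyg (G.mul_mem ha hs.1) (G.inv_mem ha), h.map_conj_mul hyg ha hs.1,
    hs.2 y hy hyg, h.map_conj_inv hyg ha, mul_one, mul_inv_cancel]

/-- The image of a normal subgroup of `G` in the simple group `T` is trivial or all of `T`. -/
theorem surj_of_normal [IsSimpleGroup T] (h : IsFaithfulProjection G g f) {N : Subgroup A}
    (hN : N ≤ G) (hnorm : ∀ a ∈ G, ∀ n ∈ N, a * n * a⁻¹ ∈ N) {n : A} (hn : n ∈ N)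
    (hfn : f n ≠ 1) (t : T) : ∃ m ∈ N, f m = t := by
  let I : Subgroup T :=
    { carrier := f '' N
      one_mem' := ⟨1, N.one_mem, h.map_one⟩
      mul_mem' := by
        rintro _ _ ⟨a, ha, rfl⟩ ⟨b, hb, rfl⟩
        exact ⟨a * b, N.mul_mem ha hb, h.map_mul _ (hN ha) _ (hN hb)⟩
      inv_mem' := by
        rintro _ ⟨a, ha, rfl⟩
        exact ⟨a⁻¹, N.inv_mem ha, h.map_inv (hN ha)⟩ }
  have hI : I.Normal := by
    refine ⟨?_⟩
    rintro _ ⟨a, ha, rfl⟩ u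
    obtain ⟨b, hb, rfl⟩ := h.surj u
    exact ⟨b * a * b⁻¹, hnorm b hb a ha, h.map_conj hb (hN ha)⟩
  rcases hI.eq_bot_or_eq_top with hI | hI
  · exact absurd (Subgroup.mem_bot.1 (hI ▸ (⟨n, hn, rfl⟩ : f n ∈ I))) hfn
  · exact (hI ▸ Subgroup.mem_top t : t ∈ I)

variable [Finite A]

/-- The elements of `⟨g⟩` that normalize the kernel of `f` on `G`. -/
def kernelStabilizer (h : IsFaithfulProjection G g f) : Subgroup A :=
  let M : Submonoid A :=
    { carrier := {y | y ∈ Subgroup.zpowers g ∧ ∀ a ∈ G, f (y * a * y⁻¹) = 1 → f a = 1}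
      one_mem' := ⟨one_mem _, fun a _ ha => by simpa using ha⟩
      mul_mem' := fun {y z} hy hz => ⟨mul_mem hy.1 hz.1, fun a ha hfa =>
        hz.2 a ha (hy.2 _ (h.conj_mem z hz.1 a ha) (by simpa [mul_assoc] using hfa))⟩ }
  { M with
    inv_mem' := fun {y} hy => by
      -- The defining condition is one-sided; finiteness makes `y⁻¹` a nonnegative power of `y`.
      have := M.pow_mem hy (orderOf y - 1)
      rwa [pow_sub y (orderOf_pos y), pow_orderOf_eq_one, pow_one, one_mul] at this }

theorem mem_kernelStabilizer (h : IsFaithfulProjection G g f) {y : A} :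
    y ∈ h.kernelStabilizer ↔
      y ∈ Subgroup.zpowers g ∧ ∀ a ∈ G, f (y * a * y⁻¹) = 1 → f a = 1 := Iff.rfl

theorem map_conj_eq_one (h : IsFaithfulProjection G g f) {y a : A}
    (hy : y ∈ h.kernelStabilizer) (ha : a ∈ G) (hfa : f a = 1) : f (y * a * y⁻¹) = 1 :=
  (inv_mem hy : y⁻¹ ∈ h.kernelStabilizer).2 _ (h.conj_mem y hy.1 a ha)
    (by simpa [mul_assoc] using hfa)

/-- The direct factor of `G` complementing the kernel of `f`: the intersection of the other
conjugates of this kernel. -/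
def factor (h : IsFaithfulProjection G g f) : Subgroup A :=
  h.conjKernel (h.kernelStabilizer : Set A)ᶜ

theorem map_conj_factor (h : IsFaithfulProjection G g f) {s y : A} (hs : s ∈ h.factor)
    (hy : y ∈ Subgroup.zpowers g) (hyK : y ∉ h.kernelStabilizer) : f (y * s * y⁻¹) = 1 :=
  hs.2 y hyK hy

theorem eq_one_of_mem_factor (h : IsFaithfulProjection G g f) {s : A} (hs : s ∈ h.factor)
    (hfs : f s = 1) : s = 1 := by
  refine h.faithful s hs.1 fun y hy => ?_
  by_cases hyK : y ∈ h.kernelStabilizer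
  · exact h.map_conj_eq_one hyK hs.1 hfs
  · exact h.map_conj_factor hs hy hyK

theorem injOn_factor (h : IsFaithfulProjection G g f) {s t : A} (hs : s ∈ h.factor)
    (ht : t ∈ h.factor) (hst : f s = f t) : s = t := by
  rw [← mul_inv_eq_one]
  refine h.eq_one_of_mem_factor (mul_mem hs (inv_mem ht)) ?_
  rw [h.map_mul _ hs.1 _ (G.inv_mem ht.1), h.map_inv ht.1, hst, mul_inv_cancel]

/-- The commutator of `k` and `s` lies both in the factor, which is normal in `G`, and in the kernel
of `f`; these meet trivially. -/
theorem commute_factor (h : IsFaithfulProjection G g f) {k s : A} (hk : k ∈ G) (hfk : f k = 1)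
    (hs : s ∈ h.factor) : k * s = s * k := by
  rw [← mul_inv_eq_one]
  have hks : k * s * k⁻¹ ∈ h.factor := h.conj_mem_conjKernel hk hs
  have : k * s * (s * k)⁻¹ = (k * s * k⁻¹) * s⁻¹ := by group
  rw [this]
  refine h.eq_one_of_mem_factor (mul_mem hks (inv_mem hs)) ?_
  rw [h.map_mul _ hks.1 _ (G.inv_mem hs.1), h.map_conj hk hs.1, h.map_inv hs.1, hfk]
  simp

/-- Since `y` moves the kernel, the conjugate kernel belonging to `y` has a nontrivial normal image
in `T`, hence covers `T`. A commutator of an element of the intersection for `F` with an element of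
this new kernel lies in both, and can be chosen to have nontrivial image `[u, v]`; simplicity of `T`
then gives surjectivity. -/
theorem surj_conjKernel [IsSimpleGroup T] (h : IsFaithfulProjection G g f)
    (hT : ∃ a b : T, a * b ≠ b * a) (F : Finset A) (hF : ∀ y ∈ F, y ∉ h.kernelStabilizer)
    (t : T) : ∃ s ∈ h.conjKernel F, f s = t := by
  classical
  induction F using Finset.induction_on generalizing t with
  | empty =>
    obtain ⟨a, ha, rfl⟩ := h.surj t
    exact ⟨a, ⟨ha, by simp⟩, rfl⟩
  | insert y F _ ih =>
    by_cases hy : y ∈ Subgroup.zpowers g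
    swap
    · obtain ⟨s, hs, hst⟩ := ih (fun y hy => hF y (Finset.mem_insert_of_mem hy)) t
      refine ⟨s, ⟨hs.1, fun w hw hwg => ?_⟩, hst⟩
      rcases Finset.mem_insert.1 (Finset.mem_coe.1 hw) with rfl | hw
      · exact absurd hwg hy
      · exact hs.2 w hw hwg
    obtain ⟨u, v, huv⟩ := hT
    obtain ⟨a, ha, hau⟩ := ih (fun y hy => hF y (Finset.mem_insert_of_mem hy)) u
    have hyK := hF y (Finset.mem_insert_self y F)
    rw [h.mem_kernelStabilizer] at hyK
    push Not at hyK
    obtain ⟨b₀, hb₀, hyb₀, hfb₀⟩ := hyK hy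
    obtain ⟨b, hb, hbv⟩ := h.surj_of_normal (N := h.conjKernel {y}) (fun _ hs => hs.1)
      (fun a ha n hn => h.conj_mem_conjKernel ha hn) (n := b₀)
      ⟨hb₀, fun w hw _ => by rw [Set.mem_singleton_iff.1 hw]; exact hyb₀⟩ hfb₀ v
    have h1 : a * b * a⁻¹ * b⁻¹ ∈ h.conjKernel {y} :=
      mul_mem (h.conj_mem_conjKernel ha.1 hb) (inv_mem hb)
    have h2 : a * b * a⁻¹ * b⁻¹ ∈ h.conjKernel F := by
      have := mul_mem ha (h.conj_mem_conjKernel hb.1 (inv_mem ha))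
      simpa [mul_assoc] using this
    refine h.surj_of_normal (N := h.conjKernel (insert y F : Finset A)) (fun _ hs => hs.1)
      (fun a ha n hn => h.conj_mem_conjKernel ha hn) (n := a * b * a⁻¹ * b⁻¹) ?_ ?_ t
    · refine ⟨h1.1, fun w hw hwg => ?_⟩
      rcases Finset.mem_insert.1 (Finset.mem_coe.1 hw) with rfl | hw
      · exact h1.2 w rfl hwg
      · exact h2.2 w hw hwg
    · rw [h.map_mul _ (h.conj_mem_conjKernel ha.1 hb).1 _ (G.inv_mem hb.1),
        h.map_conj ha.1 hb.1, h.map_inv hb.1, hau, hbv]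
      intro he
      apply huv
      rw [mul_inv_eq_one, mul_inv_eq_iff_eq_mul] at he
      exact he

theorem surj_factor [IsSimpleGroup T] (h : IsFaithfulProjection G g f)
    (hT : ∃ a b : T, a * b ≠ b * a) (t : T) : ∃ s ∈ h.factor, f s = t := by
  have hfin : ((h.kernelStabilizer : Set A)ᶜ).Finite := Set.toFinite _
  obtain ⟨s, hs, hst⟩ := h.surj_conjKernel hT hfin.toFinset (by simp) t
  exact ⟨s, by simpa [factor] using hs, hst⟩

/-- The conjugates of the factor generate `G`. -/
theorem le_of_conj_factor [IsSimpleGroup T] (h : IsFaithfulProjection G g f)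
    (hT : ∃ a b : T, a * b ≠ b * a) {P : Subgroup A}
    (hP : ∀ y ∈ Subgroup.zpowers g, ∀ s ∈ h.factor, y * s * y⁻¹ ∈ P) : G ≤ P := by
  classical
  intro m hm
  -- The coordinates `f (y * k * y⁻¹)` are cleared one at a time. Clearing `y` by a conjugate of a
  -- factor element leaves alone each coordinate `w` with `w * y⁻¹` outside the stabilizer; the
  -- other coordinates vanish together with `y`.
  have key : ∀ F : Finset A, (∀ y ∈ F, y ∈ Subgroup.zpowers g) →
      ∃ a ∈ P, ∃ k ∈ G, m = a * k ∧ ∀ y ∈ F, f (y * k * y⁻¹) = 1 := by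
    intro F
    induction F using Finset.induction_on with
    | empty => exact fun _ => ⟨1, P.one_mem, m, hm, by simp, by simp⟩
    | insert y F _ ih =>
      intro hF
      obtain ⟨a, ha, k, hk, hmk, hFk⟩ := ih fun y hy => hF y (Finset.mem_insert_of_mem hy)
      have hy := hF y (Finset.mem_insert_self y F)
      obtain ⟨l, hl, hfl⟩ := h.surj_factor hT (f (y * k * y⁻¹))
      have hlG : y⁻¹ * l * y ∈ G := by simpa using h.conj_mem y⁻¹ (inv_mem hy) l hl.1
      have hlP : y⁻¹ * l * y ∈ P := by simpa using hP y⁻¹ (inv_mem hy) l hl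
      have hkG := mul_mem (inv_mem hlG) hk
      have hyk : f (y * ((y⁻¹ * l * y)⁻¹ * k) * y⁻¹) = 1 := by
        rw [h.map_conj_mul hy (inv_mem hlG) hk, h.map_conj_inv hy hlG, ← hfl]
        simp [mul_assoc]
      refine ⟨a * (y⁻¹ * l * y), mul_mem ha hlP, (y⁻¹ * l * y)⁻¹ * k, hkG, ?_, ?_⟩
      · rw [hmk]; group
      intro w hw
      rcases Finset.mem_insert.1 hw with rfl | hw'
      · exact hyk
      have hwg := hF w hw
      by_cases hK : w * y⁻¹ ∈ h.kernelStabilizer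
      · have := h.map_conj_eq_one hK (h.conj_mem y hy _ hkG) hyk
        simpa [mul_assoc] using this
      · rw [h.map_conj_mul hwg (inv_mem hlG) hk, hFk w hw', h.map_conj_inv hwg hlG]
        have := h.map_conj_factor hl (mul_mem hwg (inv_mem hy)) hK
        rw [mul_inv_rev, inv_inv] at this
        simpa [mul_assoc] using this
  obtain ⟨a, ha, k, hk, hmk, hFk⟩ := key (Set.toFinite (Subgroup.zpowers g : Set A)).toFinset
    (by simp)
  have : k = 1 := h.faithful k hk fun y hy => hFk y (by simpa using hy)
  rw [hmk, this, mul_one]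
  exact ha

/-- A nontrivial normal subgroup of `G` that is invariant under `g` is all of `G`. -/
theorem le_of_invariant [IsSimpleGroup T] (h : IsFaithfulProjection G g f)
    (hT : ∃ a b : T, a * b ≠ b * a) {E : Subgroup A} (hE : E ≤ G)
    (hnorm : ∀ a ∈ G, ∀ e ∈ E, a * e * a⁻¹ ∈ E)
    (hinv : ∀ y ∈ Subgroup.zpowers g, ∀ e ∈ E, y * e * y⁻¹ ∈ E) (hne : E ≠ ⊥) : G ≤ E := by
  obtain ⟨e, he, hfe⟩ : ∃ e ∈ E, f e ≠ 1 := by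
    by_contra! hcon
    exact hne ((Subgroup.eq_bot_iff_forall E).2 fun e he =>
      h.faithful e (hE he) fun y hy => hcon _ (hinv y hy e he))
  obtain ⟨u, v, huv⟩ := id hT
  obtain ⟨a, ha, rfl⟩ := h.surj_of_normal hE hnorm he hfe u
  obtain ⟨b, hb, rfl⟩ := h.surj_factor hT v
  -- The commutator of `a ∈ E` and `b` in the factor lies in `E ⊓ h.factor` and has nontrivial
  -- image, so this intersection already covers `T`.
  have hL : ∀ s ∈ h.factor, s ∈ E := by
    intro s hs
    obtain ⟨m, hm, hms⟩ := h.surj_of_normal (N := E ⊓ h.factor) (n := a * b * a⁻¹ * b⁻¹)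
      (inf_le_left.trans hE)
      (fun c hc n hn => ⟨hnorm c hc n hn.1, h.conj_mem_conjKernel hc hn.2⟩)
      ⟨by simpa [mul_assoc] using mul_mem ha (hnorm b hb.1 _ (inv_mem ha)),
        Subgroup.mul_mem _ (h.conj_mem_conjKernel (hE ha) hb) (Subgroup.inv_mem _ hb)⟩
      (by
        rw [h.map_mul _ (h.conj_mem_conjKernel (hE ha) hb).1 _ (G.inv_mem hb.1),
          h.map_conj (hE ha) hb.1, h.map_inv hb.1]
        intro he
        rw [mul_inv_eq_one, mul_inv_eq_iff_eq_mul] at he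
        exact huv he) (f s)
    exact h.injOn_factor hm.2 hs hms ▸ hm.1
  exact h.le_of_conj_factor hT fun y hy s hs => hinv y hy s (hL s hs)

end IsFaithfulProjection

/-! ### Cyclic groups and elementary facts on nonabelian simple groups. -/

/-- In a cyclic group `⟨g⟩`, the elements outside of a subgroup `C` are detected by finitely many
elements of prime power order, at most one for each prime. -/
theorem exists_primary_elements {A : Type*} [Group A] [Finite A] (g : A) (C : Subgroup A) :
    ∃ (F : Finset ℕ) (x : ℕ → A),
      (∀ q ∈ F, q.Prime ∧ x q ∈ Subgroup.zpowers g ∧ x q ∉ C ∧ x q ^ q ∈ C ∧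
        ∃ k, x q ^ q ^ k = 1) ∧
      ∀ y ∈ Subgroup.zpowers g, y ∉ C → ∃ q ∈ F, x q ∈ Subgroup.zpowers y := by
  classical
  set n := orderOf g with hn
  have hn0 : n ≠ 0 := (orderOf_pos g).ne'
  have hgn : g ^ n ∈ C := by rw [hn, pow_orderOf_eq_one]; exact C.one_mem
  have hex : ∃ d, 0 < d ∧ g ^ d ∈ C := ⟨n, Nat.pos_of_ne_zero hn0, hgn⟩
  set d := Nat.find hex with hd
  have hd0 : d ≠ 0 := (Nat.find_spec hex).1.ne'
  have hdC : g ^ d ∈ C := (Nat.find_spec hex).2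
  have hdvd : ∀ j : ℕ, g ^ j ∈ C ↔ d ∣ j := by
    intro j
    constructor
    · intro hj
      by_contra hndvd
      have hlt : j % d < d := Nat.mod_lt _ (Nat.pos_of_ne_zero hd0)
      refine Nat.find_min hex hlt ⟨Nat.pos_of_ne_zero fun h => hndvd (Nat.dvd_of_mod_eq_zero h), ?_⟩
      have h2 : g ^ (d * (j / d)) * g ^ (j % d) = g ^ j := by rw [← pow_add, Nat.div_add_mod]
      rw [← eq_inv_mul_iff_mul_eq] at h2
      rw [h2]
      exact mul_mem (inv_mem (by rw [pow_mul]; exact pow_mem hdC _)) hj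
    · rintro ⟨k, rfl⟩
      rw [pow_mul]
      exact pow_mem hdC _
  have hdn : d ∣ n := (hdvd n).1 hgn
  -- The first factor of the exponent leaves the `q`-part of `g`; the second stops one power of `q`
  -- short of entering `C`.
  refine ⟨d.primeFactors, fun q => g ^ (n / q ^ n.factorization q * q ^ (d.factorization q - 1)),
    fun q hq => ?_, fun y hy hyC => ?_⟩
  · have hqp := Nat.prime_of_mem_primeFactors hq
    have hqd := Nat.dvd_of_mem_primeFactors hq
    have he : 1 ≤ d.factorization q := (hqp.dvd_iff_one_le_factorization hd0).1 hqd
    have hcop : Nat.Coprime q (n / q ^ n.factorization q) := Nat.coprime_ordCompl hqp hn0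
    refine ⟨hqp, pow_mem (Subgroup.mem_zpowers g) _, ?_, ?_, n.factorization q, ?_⟩
    · rw [hdvd]
      intro hdiv
      have h1 : q ^ d.factorization q ∣ n / q ^ n.factorization q * q ^ (d.factorization q - 1) :=
        (Nat.ordProj_dvd d q).trans hdiv
      have h2 := (Nat.Coprime.pow_left (d.factorization q) hcop).dvd_of_dvd_mul_left h1
      have := (Nat.pow_dvd_pow_iff_le_right hqp.one_lt).1 h2
      omega
    · rw [← pow_mul, hdvd, mul_assoc, ← pow_succ, Nat.sub_add_cancel he]
      conv_lhs => rw [← Nat.ordProj_mul_ordCompl_eq_self d q, mul_comm]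
      exact mul_dvd_mul (Nat.ordCompl_dvd_ordCompl_of_dvd hdn q) dvd_rfl
    · rw [← pow_mul, mul_right_comm, mul_comm (n / _), Nat.ordProj_mul_ordCompl_eq_self, pow_mul, hn,
        pow_orderOf_eq_one, one_pow]
  · obtain ⟨i, rfl⟩ := (mem_powers_iff_mem_zpowers.2 hy)
    simp only at hyC ⊢
    have hi : ¬ d ∣ i := fun h => hyC ((hdvd i).2 h)
    have hi0 : i ≠ 0 := fun h => hi (h ▸ dvd_zero d)
    obtain ⟨q, hq⟩ : ∃ q, i.factorization q < d.factorization q := by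
      by_contra! hcon
      exact hi ((Nat.factorization_le_iff_dvd hd0 hi0).1 hcon)
    have hqF : q ∈ d.primeFactors := by
      rw [← Nat.support_factorization, Finsupp.mem_support_iff]
      omega
    refine ⟨q, hqF, ?_⟩
    have hqp := Nat.prime_of_mem_primeFactors hqF
    have hgcd : Nat.gcd i n ∣ n / q ^ n.factorization q * q ^ (d.factorization q - 1) := by
      rw [← Nat.ordProj_mul_ordCompl_eq_self (Nat.gcd i n) q, mul_comm]
      refine mul_dvd_mul (Nat.ordCompl_dvd_ordCompl_of_dvd (Nat.gcd_dvd_right i n) q)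
        (Nat.pow_dvd_pow q ?_)
      have := (Nat.factorization_le_iff_dvd (Nat.gcd_ne_zero_left hi0) hi0).2
        (Nat.gcd_dvd_left i n) q
      omega
    have hmem : g ^ Nat.gcd i n ∈ Subgroup.zpowers (g ^ i) := by
      refine ⟨Nat.gcdA i n, ?_⟩
      simp only
      have : g ^ ((Nat.gcd i n : ℕ) : ℤ) = g ^ ((i : ℤ) * Nat.gcdA i n + n * Nat.gcdB i n) := by
        rw [Nat.gcd_eq_gcd_ab]
      rw [zpow_natCast, zpow_add, zpow_mul, zpow_mul, zpow_natCast, zpow_natCast, hn,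
        pow_orderOf_eq_one, one_zpow, mul_one] at this
      rw [this]
    obtain ⟨c, hc⟩ := hgcd
    rw [hc, pow_mul]
    exact pow_mem hmem c

theorem Subgroup.mem_of_pow_mem_of_pow_mem_of_coprime {A : Type*} [Group A] {C : Subgroup A}
    {y : A} {m n : ℕ} (hmn : m.Coprime n) (hm : y ^ m ∈ C) (hn : y ^ n ∈ C) : y ∈ C := by
  have : y ^ ((Nat.gcd m n : ℕ) : ℤ) = y ^ ((m : ℤ) * Nat.gcdA m n + n * Nat.gcdB m n) := by
    rw [Nat.gcd_eq_gcd_ab]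
  rw [zpow_natCast, zpow_add, zpow_mul, zpow_mul, zpow_natCast, zpow_natCast, hmn.gcd_eq_one,
    pow_one] at this
  rw [this]
  exact mul_mem (zpow_mem hm _) (zpow_mem hn _)

/-- In a nonabelian simple group, only the identity is central. -/
theorem exists_not_commute_of_ne_one {T : Type*} [Group T] [IsSimpleGroup T]
    (hT : ∃ a b : T, a * b ≠ b * a) {t : T} (ht : t ≠ 1) : ∃ u, u * t ≠ t * u := by
  by_contra! hcon
  have htc : t ∈ Subgroup.center T := Subgroup.mem_center_iff.2 hcon
  rcases (inferInstance : (Subgroup.center T).Normal).eq_bot_or_eq_top with h | h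
  · exact ht (Subgroup.mem_bot.1 (h ▸ htc))
  · obtain ⟨a, b, hab⟩ := hT
    exact hab (Subgroup.mem_center_iff.1 (h ▸ Subgroup.mem_top b) a)

theorem exists_sq_ne_one_of_not_commute {T : Type*} [Group T]
    (hT : ∃ a b : T, a * b ≠ b * a) : ∃ t : T, t * t ≠ 1 := by
  by_contra! hcon
  obtain ⟨a, b, hab⟩ := hT
  apply hab
  have h := hcon (a * b)
  rw [mul_eq_one_iff_eq_inv, mul_inv_rev, ← mul_eq_one_iff_eq_inv.1 (hcon a),
    ← mul_eq_one_iff_eq_inv.1 (hcon b)] at h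
  exact h

theorem Subgroup.mul_comm_of_mem_zpowers {A : Type*} [Group A] {g a b : A}
    (ha : a ∈ Subgroup.zpowers g) (hb : b ∈ Subgroup.zpowers g) : a * b = b * a := by
  obtain ⟨i, rfl⟩ := ha
  obtain ⟨j, rfl⟩ := hb
  exact (Commute.zpow_zpow (Commute.refl g) i j).eq

/-! ### The centralizer of an element that moves the kernel. -/

namespace IsFaithfulProjection

variable {A T : Type*} [Group A] [Group T] {G : Subgroup A} {g : A} {f : A → T}

/-- The element `(s * x) ^ j * (x ^ j)⁻¹` is the product of the conjugates `x ^ t * s * (x ^ t)⁻¹`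
for `t < j`, in increasing order of `t`. -/
theorem twisted_pow_mem (h : IsFaithfulProjection G g f) {x s : A}
    (hx : x ∈ Subgroup.zpowers g) (hs : s ∈ G) (j : ℕ) : (s * x) ^ j * (x ^ j)⁻¹ ∈ G := by
  induction j with
  | zero => simp
  | succ j ih =>
    have : (s * x) ^ (j + 1) * (x ^ (j + 1))⁻¹ =
        ((s * x) ^ j * (x ^ j)⁻¹) * (x ^ j * s * (x ^ j)⁻¹) := by
      rw [pow_succ, pow_succ]; group
    rw [this]
    exact mul_mem ih (h.conj_mem _ (pow_mem hx j) s hs)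

theorem map_conj_twisted_pow (h : IsFaithfulProjection G g f) {x s y : A}
    (hx : x ∈ Subgroup.zpowers g) (hs : s ∈ G) (hy : y ∈ Subgroup.zpowers g) (j : ℕ)
    (hj : ∀ t < j, f (y * x ^ t * s * (y * x ^ t)⁻¹) = 1) :
    f (y * ((s * x) ^ j * (x ^ j)⁻¹) * y⁻¹) = 1 := by
  induction j with
  | zero => simpa using h.map_one
  | succ j ih =>
    have : (s * x) ^ (j + 1) * (x ^ (j + 1))⁻¹ =
        ((s * x) ^ j * (x ^ j)⁻¹) * (x ^ j * s * (x ^ j)⁻¹) := by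
      rw [pow_succ, pow_succ]; group
    rw [this, h.map_conj_mul hy (h.twisted_pow_mem hx hs j) (h.conj_mem _ (pow_mem hx j) s hs),
      ih fun t ht => hj t (by omega), one_mul, ← hj j (by omega)]
    congr 1
    group

variable [Finite A]

theorem mem_kernelStabilizer_of_mem_centralizer (h : IsFaithfulProjection G g f) {y : A}
    (hy : y ∈ Subgroup.zpowers g) (hyC : y ∈ Subgroup.centralizer (G : Set A)) :
    y ∈ h.kernelStabilizer := by
  refine ⟨hy, fun a ha hfa => ?_⟩
  rwa [← Subgroup.mem_centralizer_iff.1 hyC a ha, mul_inv_cancel_right] at hfa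

theorem pow_notMem_kernelStabilizer (h : IsFaithfulProjection G g f) {x : A}
    (hx : x ∈ Subgroup.zpowers g) {q : ℕ} (hq : q.Prime)
    (hxq : x ^ q ∈ Subgroup.centralizer (G : Set A)) (hxK : x ∉ h.kernelStabilizer) {t : ℕ}
    (ht0 : 0 < t) (htq : t < q) : x ^ t ∉ h.kernelStabilizer := fun ht =>
  hxK (Subgroup.mem_of_pow_mem_of_pow_mem_of_coprime
    (Nat.coprime_of_lt_prime ht0.ne' htq hq).symm ht
    (h.mem_kernelStabilizer_of_mem_centralizer (pow_mem hx q) hxq))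

theorem map_twisted_pow (h : IsFaithfulProjection G g f) {x s : A}
    (hx : x ∈ Subgroup.zpowers g) {q : ℕ} (hq : q.Prime)
    (hxq : x ^ q ∈ Subgroup.centralizer (G : Set A)) (hxK : x ∉ h.kernelStabilizer)
    (hs : s ∈ h.factor) (j : ℕ) (hj : j < q) :
    f ((s * x) ^ (j + 1) * (x ^ (j + 1))⁻¹) = f s := by
  induction j with
  | zero => simp
  | succ j ih =>
    have : (s * x) ^ (j + 1 + 1) * (x ^ (j + 1 + 1))⁻¹ =
        ((s * x) ^ (j + 1) * (x ^ (j + 1))⁻¹) * (x ^ (j + 1) * s * (x ^ (j + 1))⁻¹) := by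
      rw [pow_succ _ (j + 1), pow_succ _ (j + 1)]; group
    rw [this, h.map_mul _ (h.twisted_pow_mem hx hs.1 _) _ (h.conj_mem _ (pow_mem hx _) s hs.1),
      ih (by omega), h.map_conj_factor hs (pow_mem hx _)
        (h.pow_notMem_kernelStabilizer hx hq hxq hxK (by omega) hj), mul_one]

/-- The product of the conjugates of `s` by the powers of `x` centralizes `x`. -/
theorem twisted_pow_mem_centralizer (h : IsFaithfulProjection G g f) {x s : A}
    (hx : x ∈ Subgroup.zpowers g) {q : ℕ} (hq : q.Prime)
    (hxq : x ^ q ∈ Subgroup.centralizer (G : Set A)) (hxK : x ∉ h.kernelStabilizer)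
    (hs : s ∈ h.factor) :
    (s * x) ^ q * (x ^ q)⁻¹ ∈ G ⊓ Subgroup.centralizer {x} ∧
      f ((s * x) ^ q * (x ^ q)⁻¹) = f s := by
  have hG := h.twisted_pow_mem hx hs.1 q
  have hf : f ((s * x) ^ q * (x ^ q)⁻¹) = f s := by
    obtain ⟨j, rfl⟩ := Nat.exists_eq_succ_of_ne_zero hq.ne_zero
    exact h.map_twisted_pow hx hq hxq hxK hs j (by omega)
  refine ⟨⟨hG, Subgroup.mem_centralizer_singleton_iff.2 ?_⟩, hf⟩
  set n := (s * x) ^ q * (x ^ q)⁻¹ with hn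
  -- Conjugation by `x` and by `s⁻¹` agree on `n`: both turn `(s * x) ^ q` into `(x * s) ^ q`, and
  -- `x ^ q` commutes with `s`. And `s` commutes with `n` because `s⁻¹ * n` lies in the kernel of
  -- `f`.
  have hcomm : s⁻¹ * n * s = s * (s⁻¹ * n) := h.commute_factor (mul_mem (inv_mem hs.1) hG)
    (by rw [h.map_mul _ (inv_mem hs.1) _ hG, h.map_inv hs.1, hf, inv_mul_cancel]) hs
  have hconj : x * n * x⁻¹ = s⁻¹ * n * s := by
    have h1 : s⁻¹ * (s * x) ^ q * s = (x * s) ^ q := by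
      have := conj_pow (i := q) (a := s⁻¹) (b := s * x)
      rw [inv_inv] at this
      rw [← this]; congr 1; group
    have h2 : x * (s * x) ^ q * x⁻¹ = (x * s) ^ q := by
      rw [← conj_pow]; congr 1; group
    have h3 : s * x ^ q = x ^ q * s := Subgroup.mem_centralizer_iff.1 hxq s hs.1
    have h4 : (x ^ q)⁻¹ * s = s * (x ^ q)⁻¹ := by
      rw [inv_mul_eq_iff_eq_mul, ← mul_assoc, ← h3, mul_inv_cancel_right]
    calc x * n * x⁻¹ = (x * (s * x) ^ q * x⁻¹) * (x * (x ^ q)⁻¹ * x⁻¹) := by rw [hn]; group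
      _ = (s⁻¹ * (s * x) ^ q * s) * (x * (x ^ q)⁻¹ * x⁻¹) := by rw [h2, h1]
      _ = s⁻¹ * (s * x) ^ q * (s * (x ^ q)⁻¹) := by group
      _ = s⁻¹ * n * s := by rw [← h4, hn]; group
  rw [hcomm, mul_inv_cancel_left] at hconj
  exact (mul_inv_eq_iff_eq_mul.1 hconj).symm

/-- The centralizer in `G` of an element `x` moving the kernel inherits the projection. -/
theorem centralizer (h : IsFaithfulProjection G g f) [IsSimpleGroup T]
    (hT : ∃ a b : T, a * b ≠ b * a) {x : A}
    (hx : x ∈ Subgroup.zpowers g) {q : ℕ} (hq : q.Prime)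
    (hxq : x ^ q ∈ Subgroup.centralizer (G : Set A)) (hxK : x ∉ h.kernelStabilizer) :
    IsFaithfulProjection (G ⊓ Subgroup.centralizer {x}) g f where
  conj_mem y hy a ha := by
    refine ⟨h.conj_mem y hy a ha.1, Subgroup.mem_centralizer_singleton_iff.2 ?_⟩
    have h1 : Commute a x := Subgroup.mem_centralizer_singleton_iff.1 ha.2
    have h2 : Commute y x := Subgroup.mul_comm_of_mem_zpowers hy hx
    exact (h2.mul_left h1).mul_left h2.inv_left
  map_mul a ha b hb := h.map_mul a ha.1 b hb.1
  surj t := by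
    obtain ⟨s, hs, rfl⟩ := h.surj_factor hT t
    exact ⟨_, h.twisted_pow_mem_centralizer hx hq hxq hxK hs⟩
  faithful a ha := h.faithful a ha.1

/-- If every `y * x ^ t` moved the kernel, then for `s ≠ 1` in the factor the product of its
conjugates under `x` would have image `f s ≠ 1`, while its conjugate by `y` would have trivial
image. -/
theorem exists_mul_pow_mem_kernelStabilizer (h : IsFaithfulProjection G g f) [IsSimpleGroup T]
    (hT : ∃ a b : T, a * b ≠ b * a) {x y : A}
    (hx : x ∈ Subgroup.zpowers g) {q : ℕ} (hq : q.Prime)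
    (hxq : x ^ q ∈ Subgroup.centralizer (G : Set A)) (hxK : x ∉ h.kernelStabilizer)
    (hy : y ∈ (h.centralizer hT hx hq hxq hxK).kernelStabilizer) :
    ∃ t : ℕ, y * x ^ t ∈ h.kernelStabilizer := by
  by_contra! hcon
  obtain ⟨u, hu⟩ := exists_ne (1 : T)
  obtain ⟨s, hs, rfl⟩ := h.surj_factor hT u
  obtain ⟨hD, hf⟩ := h.twisted_pow_mem_centralizer hx hq hxq hxK hs
  refine hu (hf ▸ hy.2 _ hD (h.map_conj_twisted_pow hx hs.1 hy.1 q fun t _ => ?_))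
  exact h.map_conj_factor hs (mul_mem hy.1 (pow_mem hx t)) (hcon t)

/-- Modulo the kernel of `f` every element of `G` is represented in `D = C_G(x)`, which `w`
centralizes, so all commutators `[w, a]` lie in the kernel. As `w` commutes with `⟨g⟩`, they lie in
every conjugate of the kernel. -/
theorem mem_centralizer_of_mem_centralizer (h : IsFaithfulProjection G g f) [IsSimpleGroup T]
    (hT : ∃ a b : T, a * b ≠ b * a) {x w : A}
    (hx : x ∈ Subgroup.zpowers g) {q : ℕ} (hq : q.Prime)
    (hxq : x ^ q ∈ Subgroup.centralizer (G : Set A)) (hxK : x ∉ h.kernelStabilizer)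
    (hw : w ∈ h.kernelStabilizer)
    (hwD : w ∈ Subgroup.centralizer ((G ⊓ Subgroup.centralizer {x} : Subgroup A) : Set A)) :
    w ∈ Subgroup.centralizer (G : Set A) := by
  have hmod : ∀ a ∈ G, f (w * a * w⁻¹ * a⁻¹) = 1 := by
    intro a ha
    obtain ⟨d, hd, hfd⟩ := (h.centralizer hT hx hq hxq hxK).surj (f a)
    have hdw := Subgroup.mem_centralizer_iff.1 hwD d hd
    have hk : d⁻¹ * a ∈ G := mul_mem (inv_mem hd.1) ha
    have hfk : f (d⁻¹ * a) = 1 := by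
      rw [h.map_mul _ (inv_mem hd.1) _ ha, h.map_inv hd.1, hfd, inv_mul_cancel]
    have hwa : w * a * w⁻¹ = d * (w * (d⁻¹ * a) * w⁻¹) := by
      have : w * a * w⁻¹ = (w * d) * (d⁻¹ * a) * w⁻¹ := by group
      rw [this, ← hdw]; group
    rw [h.map_mul _ (h.conj_mem w hw.1 a ha) _ (inv_mem ha), hwa,
      h.map_mul _ hd.1 _ (h.conj_mem w hw.1 _ hk), h.map_conj_eq_one hw hk hfk, h.map_inv ha, hfd]
    simp
  refine Subgroup.mem_centralizer_iff.2 fun a ha => ?_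
  have hfin : w * a * w⁻¹ * a⁻¹ = 1 := by
    refine h.faithful _ (mul_mem (h.conj_mem w hw.1 a ha) (inv_mem ha)) fun y hy => ?_
    rw [← hmod _ (h.conj_mem y hy a ha)]
    have hc := Subgroup.mul_comm_of_mem_zpowers hy hw.1
    congr 1
    calc y * (w * a * w⁻¹ * a⁻¹) * y⁻¹
        = (y * w) * a * (y * w)⁻¹ * (y * a * y⁻¹)⁻¹ := by group
      _ = w * (y * a * y⁻¹) * w⁻¹ * (y * a * y⁻¹)⁻¹ := by rw [hc]; group
  rw [mul_inv_eq_one, mul_inv_eq_iff_eq_mul] at hfin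
  exact hfin.symm

end IsFaithfulProjection

/-! ### Subgroups whose conjugates contain `x` or its centralizer. -/

namespace IsFaithfulProjection

variable {A T : Type*} [Group A] [Group T] {G : Subgroup A} {g : A} {f : A → T} [Finite A]

/-- A subgroup containing the centralizer of `x` in `G` and meeting the factor nontrivially
contains the factor. -/
theorem factor_le_of_mem (h : IsFaithfulProjection G g f) [IsSimpleGroup T]
    {D H : Subgroup A} (hDG : D ≤ G) (hD : ∀ t, ∃ d ∈ D, f d = t) (hDH : D ≤ H) {s : A}
    (hs : s ∈ h.factor) (hsH : s ∈ H) (hs1 : s ≠ 1) : h.factor ≤ H := by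
  intro l hl
  obtain ⟨m, hm, hml⟩ := h.surj_of_normal (N := h.factor ⊓ H) (fun _ hn => hn.1.1) (n := s)
    (fun a ha n hn => by
      refine ⟨h.conj_mem_conjKernel ha hn.1, ?_⟩
      -- The kernel of `f` centralizes the factor, so `a` acts on it as an element `d` of `D ≤ H`
      -- with the same image.
      obtain ⟨d, hd, hfd⟩ := hD (f a)
      have hk : d⁻¹ * a * n = n * (d⁻¹ * a) :=
        h.commute_factor (mul_mem (inv_mem (hDG hd)) ha)
          (by rw [h.map_mul _ (inv_mem (hDG hd)) _ ha, h.map_inv (hDG hd), hfd, inv_mul_cancel])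
          hn.1
      have : a * n * a⁻¹ = d * n * d⁻¹ := by
        calc a * n * a⁻¹ = d * (d⁻¹ * a * n) * a⁻¹ := by group
          _ = d * n * d⁻¹ := by rw [hk]; group
      rw [this]
      exact H.mul_mem (H.mul_mem (hDH hd) hn.2) (H.inv_mem (hDH hd)))
    ⟨hs, hsH⟩ (fun hfs => hs1 (h.eq_one_of_mem_factor hs hfs)) (f l)
  exact h.injOn_factor hm.1 hl hml ▸ hm.2

/-- If `x ∉ H` moves the kernel, `H` contains the centralizer `D` of `x` in `G`, and every
`G`-conjugate of `H` contains `x` or `D`, then `H` contains the factor. -/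
theorem factor_le_of_forall_conj (h : IsFaithfulProjection G g f) [IsSimpleGroup T]
    (hT : ∃ a b : T, a * b ≠ b * a) {x : A} (hx : x ∈ Subgroup.zpowers g)
    (hxK : x ∉ h.kernelStabilizer) {D H : Subgroup A} (hDG : D ≤ G)
    (hDx : ∀ d ∈ D, x * d = d * x) (hD : ∀ t, ∃ d ∈ D, f d = t) (hDH : D ≤ H)
    (hH : ∀ z ∈ G, z * x * z⁻¹ ∈ H ∨ ∀ d ∈ D, z * d * z⁻¹ ∈ H) : h.factor ≤ H := by
  by_contra hcon
  have htriv : ∀ s ∈ h.factor, s ∈ H → s = 1 := fun s hs hsH => by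
    by_contra hs1
    exact hcon (h.factor_le_of_mem hDG hD hDH hs hsH hs1)
  -- In the other alternative `H` contains both `D` and its conjugate by `s`, hence all commutators
  -- `[s, d]`; these lie in the factor, so are trivial, although some `d` has an image not commuting
  -- with `f s`.
  have hconj : ∀ s ∈ h.factor, s ≠ 1 → s * x * s⁻¹ ∈ H := by
    intro s hs hs1
    refine (hH s hs.1).resolve_right fun hsD => ?_
    have hfs : f s ≠ 1 := fun hfs => hs1 (h.eq_one_of_mem_factor hs hfs)
    obtain ⟨u, hu⟩ := exists_not_commute_of_ne_one hT hfs
    obtain ⟨d, hd, rfl⟩ := hD u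
    have h1 : s * (d * s⁻¹ * d⁻¹) ∈ h.factor :=
      mul_mem hs (h.conj_mem_conjKernel (hDG hd) (inv_mem hs))
    have h2 := htriv _ h1 (by simpa [mul_assoc] using mul_mem (hsD d hd) (inv_mem (hDH hd)))
    apply hu
    have h3 : d * s = s * d := by
      calc d * s = (s * (d * s⁻¹ * d⁻¹))⁻¹ * (s * d) := by group
        _ = s * d := by rw [h2]; group
    rw [← h.map_mul _ (hDG hd) _ hs.1, h3, h.map_mul _ hs.1 _ (hDG hd)]
  have hcomm : ∀ s ∈ h.factor, ∀ l ∈ h.factor, x * l * x⁻¹ * s = s * (x * l * x⁻¹) :=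
    fun s hs l hl => h.commute_factor (h.conj_mem x hx l hl.1) (h.map_conj_factor hl hx hxK) hs
  have hquot : ∀ s ∈ h.factor, ∀ t ∈ h.factor, s ≠ 1 → t ≠ 1 →
      s * t⁻¹ * (x * (s⁻¹ * t) * x⁻¹) ∈ H := by
    intro s hs t ht hs1 ht1
    have h1 := mul_mem (hconj s hs hs1) (inv_mem (hconj t ht ht1))
    have h2 := hcomm _ (inv_mem ht) _ (mul_mem (inv_mem hs) ht)
    have h3 : s * x * s⁻¹ * (t * x * t⁻¹)⁻¹ = s * (x * (s⁻¹ * t) * x⁻¹ * t⁻¹) := by group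
    rwa [h3, h2, ← mul_assoc] at h1
  -- The pairs `(s, a⁻¹ * s)` and `(a⁻¹, a⁻¹ * a⁻¹)` have the same quotient `a`. Dividing the two
  -- instances of `hquot` leaves the conjugate by `x` of a commutator, nontrivial because `s` and
  -- `a` do not commute; `a * a ≠ 1` makes the second pair admissible.
  obtain ⟨τ, hτ⟩ := exists_sq_ne_one_of_not_commute hT
  obtain ⟨a, ha, rfl⟩ := h.surj_factor hT τ
  have hfa : f a ≠ 1 := fun h1 => hτ (by rw [h1, one_mul])
  obtain ⟨σ, hσ⟩ := exists_not_commute_of_ne_one hT hfa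
  obtain ⟨s, hs, rfl⟩ := h.surj_factor hT σ
  have hsa : s * a ≠ a * s := fun h1 => hσ (by
    rw [← h.map_mul _ hs.1 _ ha.1, h1, h.map_mul _ ha.1 _ hs.1])
  have ha1 : a⁻¹ ≠ 1 := fun h1 => hfa (by rw [inv_eq_one.1 h1, h.map_one])
  have haa : a⁻¹ * a⁻¹ ≠ 1 := fun h1 => hτ (by
    rw [← h.map_mul _ ha.1 _ ha.1, ← h.map_one, ← inv_one, ← h1, mul_inv_rev, inv_inv])
  have hs1 : s ≠ 1 := fun h1 => hsa (by rw [h1, one_mul, mul_one])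
  have has : a⁻¹ * s ≠ 1 := fun h1 => hsa (by rw [inv_mul_eq_one.1 h1])
  have ha' := inv_mem ha
  have e1 := hquot s hs (a⁻¹ * s) (mul_mem ha' hs) hs1 has
  have e2 := hquot a⁻¹ ha' (a⁻¹ * a⁻¹) (mul_mem ha' ha') ha1 haa
  have e3 := mul_mem (inv_mem e2) e1
  have e4 : (a⁻¹ * (a⁻¹ * a⁻¹)⁻¹ * (x * (a⁻¹⁻¹ * (a⁻¹ * a⁻¹)) * x⁻¹))⁻¹ *
      (s * (a⁻¹ * s)⁻¹ * (x * (s⁻¹ * (a⁻¹ * s)) * x⁻¹)) =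
      x * (a * s⁻¹ * a⁻¹ * s) * x⁻¹ := by group
  rw [e4] at e3
  -- As `x` centralizes `D`, this conjugate of `H` contains `D` as well, and it now meets the factor
  -- nontrivially.
  have hxL : h.factor ≤ H.comap (MulAut.conj x).toMonoidHom := by
    refine h.factor_le_of_mem hDG hD (s := a * s⁻¹ * a⁻¹ * s) (fun d hd => ?_)
      (mul_mem (mul_mem (mul_mem ha (inv_mem hs)) ha') hs) ?_ ?_
    · simpa [hDx d hd] using hDH hd
    · simpa using e3
    · intro h1
      apply hsa
      calc s * a = s * 1⁻¹ * a := by group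
        _ = a * s := by rw [← h1]; group
  apply hcon
  intro l hl
  have hl' : s⁻¹ * l * s ∈ h.factor := mul_mem (mul_mem (inv_mem hs) hl) hs
  have h1 : x * (s⁻¹ * l * s) * x⁻¹ ∈ H := by simpa using hxL hl'
  have h2 := hcomm s hs _ hl'
  have h3 := hconj s hs hs1
  have h4 : l = (s * x * s⁻¹)⁻¹ * (x * (s⁻¹ * l * s) * x⁻¹) * (s * x * s⁻¹) := by
    calc l = s * x⁻¹ * (s⁻¹ * (s * (x * (s⁻¹ * l * s) * x⁻¹))) * x * s⁻¹ := by group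
      _ = s * x⁻¹ * (s⁻¹ * (x * (s⁻¹ * l * s) * x⁻¹ * s)) * x * s⁻¹ := by rw [h2]
      _ = _ := by group
  rw [h4]
  exact mul_mem (mul_mem (inv_mem h3) h1) h3

/-- If every `G`-conjugate of `H` contains the noncentral element `x` of `⟨g⟩`, then `G ≤ H`. -/
theorem le_of_forall_conj_mem (h : IsFaithfulProjection G g f) [IsSimpleGroup T]
    (hT : ∃ a b : T, a * b ≠ b * a) {x : A} (hx : x ∈ Subgroup.zpowers g)
    (hxC : x ∉ Subgroup.centralizer (G : Set A)) {H : Subgroup A}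
    (hH : ∀ z ∈ G, z * x * z⁻¹ ∈ H) : G ≤ H := by
  let S : Set A := {e | ∃ z ∈ G, e = z * x * z⁻¹ * x⁻¹}
  have hS : S ⊆ G := by
    rintro _ ⟨z, hz, rfl⟩
    simpa [mul_assoc] using mul_mem hz (h.conj_mem x hx _ (inv_mem hz))
  have hle : Subgroup.closure S ≤ H := by
    rw [Subgroup.closure_le]
    rintro _ ⟨z, hz, rfl⟩
    exact mul_mem (hH z hz) (inv_mem (by simpa using hH 1 (one_mem G)))
  have hconj : ∀ a : A, (∀ e ∈ S, a * e * a⁻¹ ∈ Subgroup.closure S) →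
      ∀ e ∈ Subgroup.closure S, a * e * a⁻¹ ∈ Subgroup.closure S := by
    intro a ha e he
    have : Subgroup.closure S ≤ (Subgroup.closure S).comap (MulAut.conj a).toMonoidHom := by
      rw [Subgroup.closure_le]
      intro e he
      simpa using ha e he
    simpa using this he
  refine le_trans (h.le_of_invariant hT ((Subgroup.closure_le G).2 hS) (fun a ha => hconj a ?_)
    (fun y hy => hconj y ?_) ?_) hle
  · rintro _ ⟨z, hz, rfl⟩
    -- The identity used is `a[z,x]a⁻¹ = [az,x][a,x]⁻¹`.
    have haz : a * z * x * (a * z)⁻¹ * x⁻¹ ∈ S := ⟨a * z, mul_mem ha hz, rfl⟩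
    have ha' : a * x * a⁻¹ * x⁻¹ ∈ S := ⟨a, ha, rfl⟩
    have h1 := mul_mem (Subgroup.subset_closure haz) (inv_mem (Subgroup.subset_closure ha'))
    convert h1 using 1
    group
  · rintro _ ⟨z, hz, rfl⟩
    refine Subgroup.subset_closure ⟨y * z * y⁻¹, h.conj_mem y hy z hz, ?_⟩
    have hc := Subgroup.mul_comm_of_mem_zpowers hy hx
    have h2 : x = y⁻¹ * x * y := by rw [mul_assoc, ← hc]; group
    calc y * (z * x * z⁻¹ * x⁻¹) * y⁻¹ = y * z * x * z⁻¹ * (y * x)⁻¹ := by group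
      _ = y * z * x * z⁻¹ * (x * y)⁻¹ := by rw [hc]
      _ = y * z * (y⁻¹ * x * y) * z⁻¹ * (x * y)⁻¹ := by rw [← h2]
      _ = _ := by group
  · intro hbot
    apply hxC
    refine Subgroup.mem_centralizer_iff.2 fun z hz => ?_
    have hzS : z * x * z⁻¹ * x⁻¹ ∈ S := ⟨z, hz, rfl⟩
    have := (Subgroup.eq_bot_iff_forall _).1 hbot _ (Subgroup.subset_closure hzS)
    rwa [mul_inv_eq_one, mul_inv_eq_iff_eq_mul] at this

end IsFaithfulProjection

/-! ### The case of trivial radical. -/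

/-- Let `⟨g⟩` permute transitively the simple factors of `G`, such that the stabilizer of a factor
induces a `p`-group of automorphisms. Then every subgroup not containing `G` has a `G`-conjugate
whose intersection with `⟨g⟩` centralizes `G`. -/
theorem IsFaithfulProjection.exists_conj_inf_zpowers_le {A T : Type*} [Group A] [Group T]
    [Finite A] [IsSimpleGroup T] (hT : ∃ a b : T, a * b ≠ b * a) {g : A} {f : A → T} {p : ℕ}
    (hp : p.Prime) (G : Subgroup A) (h : IsFaithfulProjection G g f)
    (hstab : ∀ y ∈ h.kernelStabilizer, ∃ n, y ^ p ^ n ∈ Subgroup.centralizer (G : Set A))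
    (H : Subgroup A) (hH : ¬ G ≤ H) :
    ∃ z ∈ G, ∀ y ∈ Subgroup.zpowers g, z * y * z⁻¹ ∈ H → y ∈ Subgroup.centralizer (G : Set A) := by
  induction hcard : Nat.card G using Nat.strong_induction_on generalizing G H with
  | _ m ih =>
  subst hcard
  by_contra! hneg
  obtain ⟨F, x, hF, hdet⟩ := exists_primary_elements g (Subgroup.centralizer (G : Set A))
  have hneg' : ∀ z ∈ G, ∃ q ∈ F, z * x q * z⁻¹ ∈ H := by
    intro z hz
    obtain ⟨y, hy, hyH, hyC⟩ := hneg z hz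
    obtain ⟨q, hq, hxq⟩ := hdet y hy hyC
    refine ⟨q, hq, ?_⟩
    have : Subgroup.zpowers y ≤ H.comap (MulAut.conj z).toMonoidHom := by
      rw [Subgroup.zpowers_le]; simpa using hyH
    simpa using this hxq
  by_cases hall : ∀ q ∈ F, x q ∈ h.kernelStabilizer
  · have hFp : ∀ q ∈ F, q = p := by
      intro q hq
      obtain ⟨hqp, -, hxC, hxq, -⟩ := hF q hq
      obtain ⟨n, hn⟩ := hstab _ (hall q hq)
      by_contra hne
      exact hxC (Subgroup.mem_of_pow_mem_of_pow_mem_of_coprime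
        (((Nat.coprime_primes hqp hp).2 hne).pow_right n) hxq hn)
    obtain ⟨q, hq, -⟩ := hneg' 1 (one_mem G)
    obtain rfl := hFp q hq
    refine hH (h.le_of_forall_conj_mem hT (hF q hq).2.1 (hF q hq).2.2.1 fun z hz => ?_)
    obtain ⟨q', hq', hz'⟩ := hneg' z hz
    obtain rfl := hFp q' hq'
    exact hz'
  push Not at hall
  obtain ⟨q, hq, hxK⟩ := hall
  obtain ⟨hqp, hx, hxC, hxq, -⟩ := hF q hq
  set D := G ⊓ Subgroup.centralizer {x q} with hDdef
  have hDG : D ≤ G := inf_le_left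
  have hDx : ∀ d ∈ D, x q * d = d * x q := fun d hd =>
    (Subgroup.mem_centralizer_singleton_iff.1 hd.2).symm
  have hproj : IsFaithfulProjection D g f := h.centralizer hT hx hqp hxq hxK
  have hlt : Nat.card D < Nat.card G := by
    have hne : D < G := by
      refine lt_of_le_of_ne hDG fun heq => hxC ?_
      exact Subgroup.mem_centralizer_iff.2 fun a ha => (hDx a (heq ▸ ha)).symm
    exact Set.ncard_lt_ncard hne (Set.toFinite _)
  have hxD : x q ∈ Subgroup.centralizer (D : Set A) :=
    Subgroup.mem_centralizer_iff.2 fun d hd => (hDx d hd).symm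
  have hGD : Subgroup.centralizer (G : Set A) ≤ Subgroup.centralizer (D : Set A) :=
    Subgroup.centralizer_le hDG
  have hstabD : ∀ y ∈ hproj.kernelStabilizer,
      ∃ n, y ^ p ^ n ∈ Subgroup.centralizer (D : Set A) := by
    intro y hy
    obtain ⟨t, ht⟩ := h.exists_mul_pow_mem_kernelStabilizer hT hx hqp hxq hxK hy
    obtain ⟨n, hn⟩ := hstab _ ht
    refine ⟨n, ?_⟩
    have hc : Commute y (x q ^ t) := Subgroup.mul_comm_of_mem_zpowers hy.1 (pow_mem hx t)
    rw [hc.mul_pow] at hn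
    have := mul_mem (hGD hn) (inv_mem (pow_mem (pow_mem hxD t) (p ^ n)))
    rwa [mul_inv_cancel_right] at this
  -- If both fail, induction yields `c ∈ D` such that the conjugate of `H` by `z * c` meets `⟨g⟩` in
  -- elements centralizing `D`; some `x q'` is among them. If `q' = q`, the first alternative holds
  -- since `c` commutes with `x q`. Otherwise some `x q' * x q ^ t` preserves the kernel and
  -- centralizes `D`, hence `G`. Its `q`-th power shows that `x q' ^ q` centralizes `G`, and so does
  -- `x q'`, as `q` and `q'` are coprime.
  have hdich : ∀ z ∈ G, z * x q * z⁻¹ ∈ H ∨ ∀ d ∈ D, z * d * z⁻¹ ∈ H := by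
    intro z hz
    by_contra! hcon
    obtain ⟨hzx, d, hd, hdH⟩ := hcon
    obtain ⟨c, hc, hcH⟩ := ih _ hlt D hproj hstabD (H.comap (MulAut.conj z).toMonoidHom)
      (fun hle => hdH (by simpa using hle hd)) rfl
    obtain ⟨q', hq', hzc⟩ := hneg' (z * c) (mul_mem hz hc.1)
    obtain ⟨hqp', hx', hxC', hxq', -⟩ := hF q' hq'
    by_cases hqq : q' = q
    · subst hqq
      apply hzx
      have h1 : c * x q' * c⁻¹ = x q' := by rw [← hDx c hc, mul_inv_cancel_right]
      have h2 : z * c * x q' * (z * c)⁻¹ = z * (c * x q' * c⁻¹) * z⁻¹ := by group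
      rwa [h2, h1] at hzc
    have hy := hcH (x q') hx' (by simpa [mul_assoc] using hzc)
    obtain ⟨t, ht⟩ := h.exists_mul_pow_mem_kernelStabilizer hT hx hqp hxq hxK
      (hproj.mem_kernelStabilizer_of_mem_centralizer hx' hy)
    have hw := h.mem_centralizer_of_mem_centralizer hT hx hqp hxq hxK ht
      (mul_mem hy (pow_mem hxD t))
    apply hxC'
    refine Subgroup.mem_of_pow_mem_of_pow_mem_of_coprime ((Nat.coprime_primes hqp' hqp).2 hqq)
      hxq' ?_
    have hc : Commute (x q') (x q ^ t) := Subgroup.mul_comm_of_mem_zpowers hx' (pow_mem hx t)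
    have h1 := pow_mem hw q
    rw [hc.mul_pow, ← pow_mul, mul_comm t, pow_mul] at h1
    have := mul_mem h1 (inv_mem (pow_mem hxq t))
    rwa [mul_inv_cancel_right] at this
  obtain ⟨z, hz, hzx⟩ : ∃ z ∈ G, z * x q * z⁻¹ ∉ H := by
    by_contra! hcon
    exact hH (h.le_of_forall_conj_mem hT hx hxC hcon)
  have hzD := (hdich z hz).resolve_left hzx
  have hGz : G ≤ H.comap (MulAut.conj z).toMonoidHom := by
    -- The conjugate of `H` by `z * y` also contains `D` and inherits the dichotomy, because `y`
    -- normalizes `D` and commutes with `x q`.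
    refine h.le_of_conj_factor hT fun y hy s hs => ?_
    have hle := h.factor_le_of_forall_conj hT hx hxK (D := D)
      (H := H.comap (MulAut.conj (z * y)).toMonoidHom) hDG hDx hproj.surj (fun d hd => by
        have := hzD _ (hproj.conj_mem y hy d hd)
        simpa [mul_assoc] using this) (fun w hw => by
        have hw' : z * (y * w * y⁻¹) ∈ G := mul_mem hz (h.conj_mem y hy w hw)
        refine (hdich _ hw').imp (fun h1 => ?_) fun h1 d hd => ?_
        · have hc : y⁻¹ * x q * y = x q := by
            rw [mul_assoc, Subgroup.mul_comm_of_mem_zpowers hx hy, inv_mul_cancel_left]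
          have h2 : z * (y * w * y⁻¹) * x q * (z * (y * w * y⁻¹))⁻¹ =
              z * y * w * (y⁻¹ * x q * y) * w⁻¹ * y⁻¹ * z⁻¹ := by group
          rw [h2, hc] at h1
          simpa [mul_assoc] using h1
        · have h2 := h1 _ (hproj.conj_mem y hy d hd)
          have h3 : z * (y * w * y⁻¹) * (y * d * y⁻¹) * (z * (y * w * y⁻¹))⁻¹ =
              z * y * w * d * w⁻¹ * y⁻¹ * z⁻¹ := by group
          rw [h3] at h2
          simpa [mul_assoc] using h2)
    simpa [mul_assoc] using hle hs
  apply hH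
  intro a ha
  have := hGz (mul_mem (mul_mem (inv_mem hz) ha) hz)
  simpa [mul_assoc] using this

/-! ### Coprime actions and covering an abelian group by cosets of fixed points. -/

/-- An automorphism of `q`-power order fixing only the identity of a nontrivial finite invariant
subgroup `W` forces `q ≤ |W| - 1`. -/
theorem Subgroup.le_card_sub_one_of_fixedPointFree {U : Type*} [Group U] [Finite U] {q k : ℕ}
    (hq : q.Prime) (φ : MulAut U) (hφ : φ ^ q ^ k = 1) {W : Subgroup U} (hW : W ≠ ⊥)
    (hinv : ∀ w ∈ W, φ w ∈ W) (hfix : ∀ w ∈ W, φ w = w → w = 1) : q ≤ Nat.card W - 1 := by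
  classical
  have := Fintype.ofFinite W
  have : Fact q.Prime := ⟨hq⟩
  let e : Function.End W := fun w => ⟨φ w, hinv w w.2⟩
  have hpow : ∀ (n : ℕ) (w : W), (((e ^ n) w : W) : U) = (φ ^ n) w := by
    intro n
    induction n with
    | zero => intro w; rfl
    | succ n ih =>
      intro w
      rw [pow_succ, pow_succ]
      exact ih (e w)
  have he : e ^ q ^ k = 1 := by
    funext w
    apply Subtype.ext
    rw [hpow, hφ]
    rfl
  have hmod := Equiv.Perm.card_fixedPoints_modEq he
  have hone : Fintype.card (Function.fixedPoints e) = 1 := by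
    rw [Fintype.card_eq_one_iff]
    refine ⟨⟨1, Subtype.ext (by simp [e])⟩, fun w => Subtype.ext (Subtype.ext ?_)⟩
    exact hfix w.1 w.1.2 (congrArg Subtype.val w.2)
  rw [hone, ← Nat.card_eq_fintype_card] at hmod
  have h1 : 1 < Nat.card W := by
    rwa [Subgroup.one_lt_card_iff_ne_bot]
  exact Nat.le_of_dvd (by omega) ((Nat.modEq_iff_dvd' h1.le).1 hmod.symm)

theorem MulEquiv.map_eq_of_forall_mem {U : Type*} [Group U] [Finite U] (φ : MulAut U)
    {W : Subgroup U} (hinv : ∀ w ∈ W, φ w ∈ W) : W.map φ.toMonoidHom = W := by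
  refine Subgroup.eq_of_le_of_card_ge ?_ ?_
  · rintro _ ⟨w, hw, rfl⟩
    exact hinv w hw
  · rw [Subgroup.card_map_of_injective φ.injective]

/-- An automorphism of `q`-power order, `q ∤ |U|`, that acts trivially on a subgroup `W` and on the
cosets of `W`, is trivial. -/
theorem MulAut.eq_one_of_trivial_on_quotient {U : Type*} [Group U] [Finite U] {q k : ℕ}
    (hq : q.Prime) (hcop : ¬ q ∣ Nat.card U) (φ : MulAut U) (hφ : φ ^ q ^ k = 1)
    {W : Subgroup U} (hW : ∀ w ∈ W, φ w = w) (hquot : ∀ u, u⁻¹ * φ u ∈ W) : φ = 1 := by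
  ext u
  set c := u⁻¹ * φ u with hc
  have hu : φ u = u * c := by rw [hc, mul_inv_cancel_left]
  -- Since `φ` fixes `c`, its powers translate `u` by powers of `c`; so `c` has `q`-power order,
  -- while `q` does not divide `|U|`.
  have hpow : ∀ n : ℕ, (φ ^ n) u = u * c ^ n := by
    intro n
    induction n with
    | zero => simp
    | succ n ih =>
      rw [pow_succ', MulAut.mul_apply, ih, map_mul, map_pow, hW c (hquot u), hu, mul_assoc,
        ← pow_succ']
  have h1 := hpow (q ^ k)
  rw [hφ, MulAut.one_apply, left_eq_mul] at h1
  have h2 : c = 1 := by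
    have hcop' : Nat.Coprime (q ^ k) (Nat.card U) :=
      ((Nat.Prime.coprime_iff_not_dvd hq).2 hcop).pow_left k
    exact Subgroup.mem_bot.1 (Subgroup.mem_of_pow_mem_of_pow_mem_of_coprime (C := ⊥) hcop'
      (Subgroup.mem_bot.2 h1) (Subgroup.mem_bot.2 (pow_card_eq_one')))
  rw [hu, h2, mul_one, MulAut.one_apply]

/-- Cosets of the fixed points of commuting automorphisms of prime power orders, for distinct primes
not dividing the order of `U`, together with one coset of an invariant proper subgroup, do not cover
the finite abelian group `U`. -/
theorem exists_avoiding_fixedPoints {ι U : Type*} [CommGroup U] [Finite U] (φ : ι → MulAut U)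
    (hφ : ∀ i j, φ i * φ j = φ j * φ i) (q : ι → ℕ) (hqinj : Function.Injective q)
    (F : Finset ι) (hq : ∀ i ∈ F, (q i).Prime) (hcop : ∀ i ∈ F, ¬ q i ∣ Nat.card U)
    (hord : ∀ i ∈ F, ∃ k, φ i ^ q i ^ k = 1) (hne : ∀ i ∈ F, φ i ≠ 1)
    (Z : Subgroup U) (hZ : ∀ i, ∀ z ∈ Z, φ i z ∈ Z) (u : ι → U) (u₀ : U) :
    ∃ v, (∀ i ∈ F, φ i (v * (u i)⁻¹) ≠ v * (u i)⁻¹) ∧ (Z ≠ ⊤ → v * u₀⁻¹ ∉ Z) := by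
  classical
  induction hcard : Nat.card U using Nat.strong_induction_on generalizing U F with
  | _ m ih =>
  subst hcard
  rcases subsingleton_or_nontrivial U with hU | hU
  · exact ⟨1, fun i hi => absurd (MulEquiv.ext fun _ => Subsingleton.elim _ _) (hne i hi),
      fun hZ => absurd (Subsingleton.elim _ _) hZ⟩
  obtain ⟨W, hWmin⟩ := exists_minimal_of_wellFoundedLT
    (fun W : Subgroup U => W ≠ ⊥ ∧ ∀ i, ∀ w ∈ W, φ i w ∈ W)
    ⟨⊤, top_ne_bot, fun _ _ _ => Subgroup.mem_top _⟩
  obtain ⟨hWbot, hWinv⟩ := hWmin.prop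
  have hWmin' : ∀ V ≤ W, (∀ i, ∀ w ∈ V, φ i w ∈ V) → V = ⊥ ∨ W ≤ V := by
    intro V hVW hV
    by_cases hV0 : V = ⊥
    · exact Or.inl hV0
    · exact Or.inr (hWmin.le_of_le ⟨hV0, hV⟩ hVW)
  let ψ : ι → MulAut (U ⧸ W) := fun i =>
    QuotientGroup.congr W W (φ i) (MulEquiv.map_eq_of_forall_mem (φ i) (hWinv i))
  have hψ : ∀ i (a : U), ψ i (a : U ⧸ W) = ((φ i a : U) : U ⧸ W) := fun i a => rfl
  have hψpow : ∀ i (n : ℕ) (a : U), (ψ i ^ n) (a : U ⧸ W) = ((φ i ^ n) a : U) := by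
    intro i n
    induction n with
    | zero => intro a; rfl
    | succ n ihn => intro a; rw [pow_succ, pow_succ, MulAut.mul_apply, hψ, ihn]; rfl
  have hcardQ : Nat.card (U ⧸ W) < Nat.card U := by
    rw [Subgroup.card_eq_card_quotient_mul_card_subgroup W]
    have h1 : 1 < Nat.card W := by rwa [Subgroup.one_lt_card_iff_ne_bot]
    exact lt_mul_of_one_lt_right Nat.card_pos h1
  have hcardQ' : Nat.card (U ⧸ W) ∣ Nat.card U := Subgroup.card_quotient_dvd_card W
  obtain ⟨v', hv', hvZ'⟩ := ih _ hcardQ ψ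
    (fun i j => by
      ext a
      induction a using QuotientGroup.induction_on with
      | H a => exact congrArg _ (DFunLike.congr_fun (hφ i j) a))
    (F.filter fun i => ψ i ≠ 1) (fun i hi => hq i (Finset.mem_filter.1 hi).1)
    (fun i hi hd => hcop i (Finset.mem_filter.1 hi).1 (hd.trans hcardQ'))
    (fun i hi => by
      obtain ⟨k, hk⟩ := hord i (Finset.mem_filter.1 hi).1
      refine ⟨k, ?_⟩
      ext a
      induction a using QuotientGroup.induction_on with
      | H a => rw [hψpow, hk]; rfl)
    (fun i hi => (Finset.mem_filter.1 hi).2) (Z.map (QuotientGroup.mk' W))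
    (by
      rintro i _ ⟨z, hz, rfl⟩
      exact ⟨φ i z, hZ i z hz, rfl⟩)
    (fun i => (u i : U ⧸ W)) (u₀ : U ⧸ W) rfl
  obtain ⟨v, rfl⟩ := QuotientGroup.mk_surjective v'
  set F₂ := F.filter fun i => ψ i = 1 with hF₂
  -- The fixed points in `W` are invariant under the commuting `φ j`. By minimality they are trivial
  -- or all of `W`, and in the latter case coprimality gives `φ i = 1`.
  have hfree : ∀ i ∈ F₂, ∀ w ∈ W, φ i w = w → w = 1 := by
    intro i hi
    obtain ⟨hiF, hi1⟩ := Finset.mem_filter.1 hi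
    let V : Subgroup U :=
      { carrier := {w | w ∈ W ∧ φ i w = w}
        one_mem' := ⟨one_mem _, map_one _⟩
        mul_mem' := fun ha hb => ⟨mul_mem ha.1 hb.1, by rw [map_mul, ha.2, hb.2]⟩
        inv_mem' := fun ha => ⟨inv_mem ha.1, by rw [map_inv, ha.2]⟩ }
    rcases hWmin' V (fun w hw => hw.1) (fun j w hw => ⟨hWinv j w hw.1, by
      have := DFunLike.congr_fun (hφ i j) w
      rw [MulAut.mul_apply, MulAut.mul_apply, hw.2] at this
      exact this⟩) with hV | hV
    · intro w hw hfw
      exact (Subgroup.eq_bot_iff_forall V).1 hV w ⟨hw, hfw⟩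
    · obtain ⟨k, hk⟩ := hord i hiF
      refine absurd (MulAut.eq_one_of_trivial_on_quotient (hq i hiF) (hcop i hiF) (φ i) hk
        (fun w hw => (hV hw).2) fun a => ?_) (hne i hiF)
      rw [← QuotientGroup.eq, ← hψ, hi1]
      rfl
  -- The primes `q i` for `i ∈ F₂` are distinct and lie between `2` and `|W| - 1`. The extra unit
  -- accounts for the coset of `Z`.
  have hcardF : F₂.card + 1 < Nat.card W := by
    have h1 : 1 < Nat.card W := by rwa [Subgroup.one_lt_card_iff_ne_bot]
    have h2 : F₂.image q ⊆ Finset.Icc 2 (Nat.card W - 1) := by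
      intro n hn
      obtain ⟨i, hi, rfl⟩ := Finset.mem_image.1 hn
      have hiF := (Finset.mem_filter.1 hi).1
      obtain ⟨k, hk⟩ := hord i hiF
      exact Finset.mem_Icc.2 ⟨(hq i hiF).two_le, Subgroup.le_card_sub_one_of_fixedPointFree
        (hq i hiF) (φ i) hk hWbot (hWinv i) (hfree i hi)⟩
    have h3 := Finset.card_le_card h2
    rw [Finset.card_image_of_injective _ hqinj, Nat.card_Icc] at h3
    omega
  by_contra! hcon
  -- Here `none` labels the coset of `Z` and `some i` that of the fixed points of `φ i`; by the
  -- choice of `v` only `i ∈ F₂` occur. Each label serves at most one point of `vW`, against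
  -- `hcardF`.
  have hbad : ∀ w : W, ∃ o ∈ insert none (F₂.image some),
      (o = none → v * w * u₀⁻¹ ∈ Z ∧ Z ≠ ⊤) ∧
      ∀ i, o = some i → φ i (v * w * (u i)⁻¹) = v * w * (u i)⁻¹ := by
    intro w
    by_cases hw : ∀ i ∈ F, φ i (v * w * (u i)⁻¹) ≠ v * w * (u i)⁻¹
    · have := hcon (v * w) hw
      exact ⟨none, by simp, fun _ => ⟨this.2, this.1⟩, by simp⟩
    · push Not at hw
      obtain ⟨i, hi, hiw⟩ := hw
      refine ⟨some i, ?_, by simp, ?_⟩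
      · simp only [Finset.mem_insert, reduceCtorEq, Finset.mem_image, Option.some.injEq,
          exists_eq_right, false_or]
        refine Finset.mem_filter.2 ⟨hi, ?_⟩
        by_contra hi1
        apply hv' i (Finset.mem_filter.2 ⟨hi, hi1⟩)
        have h1 : (v : U ⧸ W) * (u i : U ⧸ W)⁻¹ = ((v * w * (u i)⁻¹ : U) : U ⧸ W) := by
          rw [QuotientGroup.mk_mul, QuotientGroup.mk_mul, (QuotientGroup.eq_one_iff (w : U)).2 w.2,
            mul_one, QuotientGroup.mk_inv]
        rw [h1, hψ, hiw]
      · rintro j hj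
        obtain rfl := Option.some.inj hj
        exact hiw
  choose o ho hnone hsome using hbad
  have hinj : Function.Injective o := by
    intro a b hab
    rw [← div_eq_one, ← OneMemClass.coe_eq_one]
    rcases hoa : o a with _ | i
    · obtain ⟨ha, hZtop⟩ := hnone a hoa
      obtain ⟨hb, -⟩ := hnone b (hab ▸ hoa)
      have hdiff : ((a / b : W) : U) ∈ Z := by
        have := div_mem ha hb
        rwa [mul_div_mul_right_eq_div, mul_div_mul_left_eq_div] at this
      rcases hWmin' (W ⊓ Z) inf_le_left (fun i w hw => ⟨hWinv i w hw.1, hZ i w hw.2⟩) with h | h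
      · exact (Subgroup.eq_bot_iff_forall _).1 h _ ⟨(a / b).2, hdiff⟩
      · exfalso
        have hWZ : W ≤ Z := h.trans inf_le_right
        refine hvZ' (fun htop => hZtop ?_) ⟨v * a * u₀⁻¹, ha, ?_⟩
        · rw [eq_top_iff]
          intro x _
          obtain ⟨z, hz, hzx⟩ : (x : U ⧸ W) ∈ Z.map (QuotientGroup.mk' W) :=
            htop ▸ Subgroup.mem_top _
          have := mul_mem hz (hWZ (QuotientGroup.eq.1 hzx))
          rwa [mul_inv_cancel_left] at this
        · rw [map_mul, map_mul]
          simp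
    · have ha := hsome a i hoa
      have hb := hsome b i (hab ▸ hoa)
      have hi : i ∈ F₂ := by
        have := ho a
        rw [hoa] at this
        simpa using this
      refine hfree i hi _ (a / b).2 ?_
      have := congrArg₂ (· / ·) ha hb
      rwa [← map_div, mul_div_mul_right_eq_div, mul_div_mul_left_eq_div] at this
  have := Fintype.ofFinite W
  have hle : Nat.card W ≤ (insert none (F₂.image some)).card := by
    rw [Nat.card_eq_fintype_card, ← Finset.card_univ]
    exact Finset.card_le_card_of_injOn o (fun w _ => ho w) hinj.injOn
  have hle' : (insert none (F₂.image some)).card ≤ F₂.card + 1 :=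
    (Finset.card_insert_le _ _).trans (Nat.add_le_add_right Finset.card_image_le 1)
  omega

/-! ### Conjugation by a soluble normal subgroup. -/

theorem Subgroup.isSolvable_sup {G : Type*} [Group G] (M N : Subgroup G) [M.Normal]
    [Group.IsSolvable M] [Group.IsSolvable N] : Group.IsSolvable (M ⊔ N : Subgroup G) := by
  have h1 : Group.IsSolvable ((M ⊔ N).map (QuotientGroup.mk' M)) := by
    rw [Subgroup.map_sup, QuotientGroup.map_mk'_self, bot_sup_eq]
    exact Group.isSolvable_of_surjective ((QuotientGroup.mk' M).subgroupMap_surjective N)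
  refine Group.isSolvable_of_ker_le_range (Subgroup.inclusion (le_sup_left : M ≤ M ⊔ N))
    ((QuotientGroup.mk' M).subgroupMap (M ⊔ N)) ?_
  intro a ha
  have h2 : ((a : G) : G ⧸ M) = 1 := congrArg Subtype.val (MonoidHom.mem_ker.1 ha)
  exact ⟨⟨a, (QuotientGroup.eq_one_iff _).1 h2⟩, rfl⟩

theorem isSolvable_solubleRadical (G : Type*) [Group G] [Finite G] :
    Group.IsSolvable (solubleRadical G) := by
  obtain ⟨M, hM⟩ := exists_maximal_of_wellFoundedGT
    (fun N : Subgroup G => N.Normal ∧ Group.IsSolvable N) ⟨⊥, inferInstance, inferInstance⟩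
  obtain ⟨hMn, hMs⟩ := hM.prop
  have : solubleRadical G = M := by
    refine le_antisymm (sSup_le ?_) (le_sSup hM.prop)
    rintro N ⟨hNn, hNs⟩
    exact le_sup_right.trans
      (hM.le_of_ge ⟨inferInstance, Subgroup.isSolvable_sup M N⟩ le_sup_left)
  rwa [this]

/-- Let `N` be a normal subgroup whose quotient modulo `N ∩ H` is an elementary abelian
`ℓ`-group. If for each of the commuting elements `x q` of `q`-power order, for various primes `q`,
some `N`-conjugate is outside of `H`, then this holds for simultaneous `N`-conjugates. -/
theorem exists_conj_notMem_of_abelian_quotient {A : Type*} [Group A] [Finite A]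
    (H N : Subgroup A) [N.Normal] (hcomm : ∀ a ∈ N, ∀ b ∈ N, a * b * a⁻¹ * b⁻¹ ∈ H) {l : ℕ}
    (hl : l.Prime) (hexp : ∀ a ∈ N, a ^ l ∈ H) (F : Finset ℕ) (x : ℕ → A)
    (hF : ∀ q ∈ F, q.Prime ∧ ∃ k, x q ^ q ^ k = 1)
    (hxx : ∀ q ∈ F, ∀ q' ∈ F, x q * x q' = x q' * x q)
    (hmove : ∀ q ∈ F, ∃ v ∈ N, v * x q * v⁻¹ ∉ H) :
    ∃ v ∈ N, ∀ q ∈ F, v * x q * v⁻¹ ∉ H := by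
  classical
  let V : Subgroup N := H.subgroupOf N
  have hV : V.Normal := ⟨fun a ha b => by
    have h1 := mul_mem (hcomm b b.2 a a.2) (Subgroup.mem_subgroupOf.1 ha)
    rw [Subgroup.mem_subgroupOf]
    simpa using h1⟩
  let instU : CommGroup (N ⧸ V) :=
    { (inferInstance : Group (N ⧸ V)) with
      mul_comm := fun a b => by
        induction a using QuotientGroup.induction_on with
        | H a =>
        induction b using QuotientGroup.induction_on with
        | H b =>
        refine QuotientGroup.eq.2 (Subgroup.mem_subgroupOf.2 ?_)
        simpa [mul_assoc] using hcomm (b : A)⁻¹ (inv_mem b.2) (a : A)⁻¹ (inv_mem a.2) }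
  let ι := {q : ℕ // q ∈ F ∧ ∃ v : N, (v : A) * x q * (v : A)⁻¹ ∈ H}
  have hιfin : Finite ι :=
    Finite.of_injective (fun i : ι => (⟨i.1, i.2.1⟩ : F)) fun i j hij =>
      Subtype.ext (congrArg (fun a : F => (a : ℕ)) hij)
  have := Fintype.ofFinite ι
  choose v hv using fun i : ι => i.2.2
  -- The conjugate of `x i` by `v i` lies in `H` and so normalizes `H ∩ N`; the conjugation by `v i`
  -- is harmless because `N` is abelian modulo `H ∩ N`.
  have hinv : ∀ i : ι, ∀ w ∈ V, (MulAut.conjNormal (x i) : MulAut N) w ∈ V := by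
    intro i w hw
    rw [Subgroup.mem_subgroupOf] at hw ⊢
    rw [MulAut.conjNormal_apply]
    have h1 : (v i : A) * w * (v i : A)⁻¹ ∈ H := by
      simpa using mul_mem (hcomm _ (v i).2 _ w.2) hw
    have h2 := mul_mem (mul_mem (hv i) h1) (inv_mem (hv i))
    set n : N := v i * MulAut.conjNormal (x i) w * (v i)⁻¹
    have h3 : (v i : A) * x i * (v i : A)⁻¹ * ((v i : A) * w * (v i : A)⁻¹) *
        ((v i : A) * x i * (v i : A)⁻¹)⁻¹ = v i * (x i * w * (x i)⁻¹) * (v i : A)⁻¹ := by group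
    rw [h3] at h2
    have h4 := mul_mem (hcomm _ (inv_mem (v i).2) _ n.2) h2
    simpa [n, mul_assoc] using h4
  let φ : ι → MulAut (N ⧸ V) := fun i =>
    QuotientGroup.congr V V (MulAut.conjNormal (x i)) (MulEquiv.map_eq_of_forall_mem _ (hinv i))
  have hφ : ∀ i (a : N), φ i (a : N ⧸ V) = ((MulAut.conjNormal (x i) a : N) : N ⧸ V) :=
    fun _ _ => rfl
  have hφpow : ∀ i (n : ℕ) (a : N),
      (φ i ^ n) (a : N ⧸ V) = (((MulAut.conjNormal (x i) ^ n) a : N) : N ⧸ V) := by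
    intro i n
    induction n with
    | zero => intro a; rfl
    | succ n ihn => intro a; rw [pow_succ, pow_succ, MulAut.mul_apply, hφ, ihn]; rfl
  -- Thus the conjugators of `x i` into `H` form a coset of the fixed points of `φ i`.
  have hiff : ∀ (i : ι) (a : N), (a : A) * x i * (a : A)⁻¹ ∈ H ↔
      φ i ((a : N ⧸ V) * (v i : N ⧸ V)⁻¹) = (a : N ⧸ V) * (v i : N ⧸ V)⁻¹ := by
    intro i a
    set w : N := a * (v i)⁻¹ with hw
    set k : N := v i * MulAut.conjNormal (x i) ((v i)⁻¹ * w * v i) * (v i)⁻¹ with hk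
    have hkφ : (k : N ⧸ V) = φ i (w : N ⧸ V) := by
      have h1 : (k : N ⧸ V) = (v i : N ⧸ V) *
          φ i ((v i : N ⧸ V)⁻¹ * (w : N ⧸ V) * (v i : N ⧸ V)) * (v i : N ⧸ V)⁻¹ := rfl
      rw [h1, mul_comm (v i : N ⧸ V), mul_inv_cancel_right, inv_mul_cancel_comm]
    have hgoal : ((a : N ⧸ V) * (v i : N ⧸ V)⁻¹) = (w : N ⧸ V) := rfl
    rw [hgoal, ← hkφ, QuotientGroup.eq, Subgroup.mem_subgroupOf, ← H.mul_mem_cancel_right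
      (inv_mem (hv i))]
    have h2 : (a : A) * x i * (a : A)⁻¹ * ((v i : A) * x i * (v i : A)⁻¹)⁻¹ = w * (k : A)⁻¹ := by
      rw [hk, hw]
      simp only [Subgroup.coe_mul, Subgroup.coe_inv, MulAut.conjNormal_apply]
      group
    have h3 : ((k⁻¹ * w : N) : A) ∈ H ↔ (w : A) * (k : A)⁻¹ ∈ H := by
      have h4 : (k⁻¹ * w : N) ∈ V ↔ w * k⁻¹ ∈ V := hV.mem_comm_iff
      simpa [V, Subgroup.mem_subgroupOf] using h4
    rw [h2, h3]
  have hφcomm : ∀ i j, φ i * φ j = φ j * φ i := by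
    intro i j
    ext a
    induction a using QuotientGroup.induction_on with
    | H a =>
      have h1 : (MulAut.conjNormal (x i) * MulAut.conjNormal (x j) : MulAut N) =
          MulAut.conjNormal (x j) * MulAut.conjNormal (x i) := by
        rw [← map_mul, ← map_mul, hxx i i.2.1 j j.2.1]
      exact congrArg _ (DFunLike.congr_fun h1 a)
  have hφne : ∀ i, φ i ≠ 1 := by
    intro i hi
    obtain ⟨a, ha, hax⟩ := hmove i i.2.1
    exact hax ((hiff i ⟨a, ha⟩).2 (by rw [hi]; rfl))
  have hpU : IsPGroup l (N ⧸ V) := by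
    intro a
    induction a using QuotientGroup.induction_on with
    | H a =>
      refine ⟨1, ?_⟩
      rw [pow_one, ← QuotientGroup.mk_pow, QuotientGroup.eq_one_iff, Subgroup.mem_subgroupOf]
      simpa using hexp a a.2
  have : Fact l.Prime := ⟨hl⟩
  obtain ⟨m, hm⟩ := IsPGroup.iff_card.1 hpU
  have key : ∀ (Z : Subgroup (N ⧸ V)) (hZ : ∀ i, ∀ z ∈ Z, φ i z ∈ Z) (u₀ : N ⧸ V),
      ∃ a, (∀ i : ι, (i : ℕ) ≠ l → φ i (a * (v i : N ⧸ V)⁻¹) ≠ a * (v i : N ⧸ V)⁻¹) ∧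
        (Z ≠ ⊤ → a * u₀⁻¹ ∉ Z) := by
    intro Z hZ u₀
    obtain ⟨a, ha, haZ⟩ := exists_avoiding_fixedPoints φ hφcomm (fun i => (i : ℕ))
      Subtype.val_injective (Finset.univ.filter fun i : ι => (i : ℕ) ≠ l)
      (fun i _ => (hF i i.2.1).1) (fun i hi hd => by
        rw [hm] at hd
        exact (Finset.mem_filter.1 hi).2
          ((Nat.prime_dvd_prime_iff_eq (hF i i.2.1).1 hl).1 ((hF i i.2.1).1.dvd_of_dvd_pow hd)))
      (fun i _ => by
        obtain ⟨k, hk⟩ := (hF i i.2.1).2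
        refine ⟨k, ?_⟩
        ext a
        induction a using QuotientGroup.induction_on with
        | H a => rw [hφpow, ← map_pow, hk, map_one]; rfl)
      (fun i _ => hφne i) Z hZ (fun i => (v i : N ⧸ V)) u₀
    exact ⟨a, fun i hi => ha i (Finset.mem_filter.2 ⟨Finset.mem_univ _, hi⟩), haZ⟩
  -- The prime `l` may divide `|N ⧸ V|`, but it occurs at most once; its fixed points serve as the
  -- extra subgroup `Z`, for which no coprimality is needed.
  by_cases hlι : l ∈ F ∧ ∃ v : N, (v : A) * x l * (v : A)⁻¹ ∈ H
  · let i₀ : ι := ⟨l, hlι⟩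
    let Z : Subgroup (N ⧸ V) :=
      { carrier := {z | φ i₀ z = z}
        one_mem' := map_one _
        mul_mem' := fun {a b} (ha : φ i₀ a = a) (hb : φ i₀ b = b) => by
          simp only [Set.mem_ofPred_eq, map_mul, ha, hb]
        inv_mem' := fun {a} (ha : φ i₀ a = a) => by
          simp only [Set.mem_ofPred_eq, map_inv, ha] }
    have hZmem : ∀ z, z ∈ Z ↔ φ i₀ z = z := fun _ => Iff.rfl
    obtain ⟨a, ha, haZ⟩ := key Z (fun i z hz => by
      have := DFunLike.congr_fun (hφcomm i₀ i) z
      rw [MulAut.mul_apply, MulAut.mul_apply, (hZmem z).1 hz] at this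
      exact this) (v i₀ : N ⧸ V)
    have hZtop : Z ≠ ⊤ := fun h => hφne i₀ (MulEquiv.ext fun z =>
      (hZmem z).1 (h ▸ Subgroup.mem_top z))
    obtain ⟨a, rfl⟩ := QuotientGroup.mk_surjective a
    refine ⟨a, a.2, fun q hq haq => ?_⟩
    let i : ι := ⟨q, hq, a, haq⟩
    have hfix := (hiff i a).1 haq
    by_cases hql : q = l
    · subst hql
      exact haZ hZtop hfix
    · exact ha i hql hfix
  · obtain ⟨a, ha, -⟩ := key ⊤ (fun _ _ _ => Subgroup.mem_top _) 1
    obtain ⟨a, rfl⟩ := QuotientGroup.mk_surjective a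
    refine ⟨a, a.2, fun q hq haq => ?_⟩
    let i : ι := ⟨q, hq, a, haq⟩
    by_cases hql : q = l
    · subst hql
      exact hlι i.2
    · exact ha i hql ((hiff i a).1 haq)

/-- If `M < N` with `M` normal, then some element of `N` has prime order modulo `M`. -/
theorem Subgroup.exists_prime_pow_mem_of_lt {A : Type*} [Group A] [Finite A] {M N : Subgroup A}
    [M.Normal] (hMN : M < N) : ∃ l, l.Prime ∧ ∃ n ∈ N, n ∉ M ∧ n ^ l ∈ M := by
  have hne : Nat.card (N ⧸ M.subgroupOf N) ≠ 1 := fun h => by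
    have h1 : M.subgroupOf N = ⊤ := Subgroup.index_eq_one.1 h
    exact hMN.not_ge (Subgroup.subgroupOf_eq_top.1 h1)
  obtain ⟨l, hl, hdvd⟩ := Nat.exists_prime_and_dvd hne
  have : Fact l.Prime := ⟨hl⟩
  obtain ⟨a, ha⟩ := exists_prime_orderOf_dvd_card' l hdvd
  obtain ⟨n, rfl⟩ := QuotientGroup.mk_surjective a
  refine ⟨l, hl, n, n.2, fun hn => hl.ne_one ?_, ?_⟩
  · rw [← ha, (QuotientGroup.eq_one_iff n).2 (Subgroup.mem_subgroupOf.2 hn), orderOf_one]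
  · have h1 := pow_orderOf_eq_one (n : N ⧸ M.subgroupOf N)
    rw [ha, ← QuotientGroup.mk_pow, QuotientGroup.eq_one_iff, Subgroup.mem_subgroupOf] at h1
    simpa using h1

/-- Let `G ≤ HR` with `R` a soluble normal subgroup. If no subgroup that does not contain `G`
contains all `G`-conjugates of one of the commuting elements `x q` of `q`-power order, then an
`R`-conjugate of `H` contains none of these elements. -/
theorem exists_conj_notMem_of_le_sup_isSolvable {A : Type*} [Group A] [Finite A]
    (G H R : Subgroup A) [R.Normal] [Group.IsSolvable R] (hG : G ≤ H ⊔ R) (hGH : ¬ G ≤ H)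
    (F : Finset ℕ) (x : ℕ → A) (hF : ∀ q ∈ F, q.Prime ∧ ∃ k, x q ^ q ^ k = 1)
    (hxx : ∀ q ∈ F, ∀ q' ∈ F, x q * x q' = x q' * x q)
    (hmove : ∀ K : Subgroup A, ¬ G ≤ K → ∀ q ∈ F, ∃ z ∈ G, z * x q * z⁻¹ ∉ K) :
    ∃ v ∈ R, ∀ q ∈ F, v * x q * v⁻¹ ∉ H := by
  obtain ⟨N, hN⟩ := exists_minimal_of_wellFoundedLT
    (fun N : Subgroup A => N.Normal ∧ N ≤ R ∧ G ≤ H ⊔ N) ⟨R, inferInstance, le_rfl, hG⟩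
  obtain ⟨hNn, hNR, hGN⟩ := hN.prop
  have hNbot : N ≠ ⊥ := by
    rintro rfl
    exact hGH (by simpa using hGN)
  have hcomm : ⁅N, N⁆ < N := by
    have h1 : Nontrivial N := (Subgroup.nontrivial_iff_ne_bot N).2 hNbot
    have h2 : Group.IsSolvable N :=
      Group.isSolvable_of_isSolvable_injective (Subgroup.inclusion_injective hNR)
    have h3 := Group.IsSolvable.commutator_lt_top_of_nontrivial N
    rw [← Subgroup.map_subtype_lt_map_subtype, commutator_def, Subgroup.map_commutator,
      ← MonoidHom.range_eq_map, Subgroup.range_subtype] at h3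
    exact h3
  obtain ⟨M, hM⟩ := exists_maximal_of_wellFoundedGT
    (fun M : Subgroup A => M.Normal ∧ ⁅N, N⁆ ≤ M ∧ M < N)
    ⟨⁅N, N⁆, inferInstance, le_rfl, hcomm⟩
  obtain ⟨hMn, hNM, hMN⟩ := hM.prop
  obtain ⟨l, hl, n, hnN, hnM, hnl⟩ := Subgroup.exists_prime_pow_mem_of_lt hMN
  have hcommM : ∀ a ∈ N, ∀ b ∈ N, a * b * a⁻¹ * b⁻¹ ∈ M := fun a ha b hb =>
    hNM (Subgroup.commutator_mem_commutator ha hb)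
  -- The elements of order dividing `l` modulo `M` form a normal subgroup of `A`, strictly larger
  -- than `M` because of `n`; maximality of `M` makes it `N`.
  have hpow : ∀ a ∈ N, a ^ l ∈ M := by
    let P : Subgroup A :=
      { carrier := {a | a ∈ N ∧ a ^ l ∈ M}
        one_mem' := ⟨one_mem _, by rw [one_pow]; exact one_mem _⟩
        mul_mem' := fun {a b} ha hb => by
          refine ⟨mul_mem ha.1 hb.1, ?_⟩
          have hc : Commute (a : A ⧸ M) (b : A ⧸ M) := by
            refine QuotientGroup.eq.2 ?_
            simpa [mul_assoc] using hcommM b⁻¹ (inv_mem hb.1) a⁻¹ (inv_mem ha.1)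
          rw [← QuotientGroup.eq_one_iff, QuotientGroup.mk_pow, QuotientGroup.mk_mul, hc.mul_pow,
            ← QuotientGroup.mk_pow, ← QuotientGroup.mk_pow, (QuotientGroup.eq_one_iff _).2 ha.2,
            (QuotientGroup.eq_one_iff _).2 hb.2, mul_one]
        inv_mem' := fun {a} ha => ⟨inv_mem ha.1, by rw [inv_pow]; exact inv_mem ha.2⟩ }
    have hPn : P.Normal := ⟨fun a ha c => ⟨hNn.conj_mem a ha.1 c, by
      rw [conj_pow]; exact hMn.conj_mem _ ha.2 c⟩⟩
    have hMP : M ≤ P := fun a ha => ⟨hMN.le ha, pow_mem ha l⟩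
    have hPN : P ≤ N := fun a ha => ha.1
    intro a ha
    by_contra hal
    have hlt : P < N := lt_of_le_of_ne hPN fun h => hal ((h ▸ ha : a ∈ P)).2
    exact hnM (hM.le_of_ge ⟨hPn, hNM.trans hMP, hlt⟩ hMP ⟨hnN, hnl⟩)
  have hGM : ¬ G ≤ H ⊔ M := fun h =>
    hMN.not_ge (hN.le_of_le ⟨hMn, hMN.le.trans hNR, h⟩ hMN.le)
  obtain ⟨v, hv, hvx⟩ := exists_conj_notMem_of_abelian_quotient (H ⊔ M) N
    (fun a ha b hb => Subgroup.mem_sup_right (hcommM a ha b hb)) hl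
    (fun a ha => Subgroup.mem_sup_right (hpow a ha)) F x hF hxx fun q hq => by
      obtain ⟨z, hz, hzx⟩ := hmove _ hGM q hq
      obtain ⟨a, ha, b, hb, rfl⟩ := Subgroup.mem_sup_of_normal_right.1 (hGN hz)
      refine ⟨b, hb, fun hbx => hzx ?_⟩
      have ha' : a ∈ H ⊔ M := Subgroup.mem_sup_left ha
      have := mul_mem (mul_mem ha' hbx) (inv_mem ha')
      simpa [mul_assoc] using this
  exact ⟨v, hNR hv, fun q hq h => hvx q hq (Subgroup.mem_sup_left h)⟩

/-! ### Projection onto a simple factor modulo the radical. -/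

namespace IsInternalDirectProduct

variable {Q ι : Type*} [Group Q] {S : ι → Subgroup Q}

theorem commute (h : IsInternalDirectProduct S) {i j : ι} (hij : i ≠ j) {a b : Q} (ha : a ∈ S i)
    (hb : b ∈ S j) : Commute a b :=
  Subgroup.commute_of_normal_of_disjoint _ _ (h.normal i) (h.normal j)
    (h.independent.pairwiseDisjoint hij) a b ha hb

theorem exists_eq_mul (h : IsInternalDirectProduct S) (i : ι) (a : Q) :
    ∃ s ∈ S i, ∃ k ∈ Subgroup.centralizer (S i : Set Q), s * k = a := by
  have := h.normal i
  refine Subgroup.mem_sup_of_normal_left.1 ?_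
  have htop : (⊤ : Subgroup Q) ≤ S i ⊔ Subgroup.centralizer (S i : Set Q) := by
    rw [← h.iSup_eq_top]
    refine iSup_le fun j => ?_
    by_cases hij : i = j
    · exact hij ▸ le_sup_left
    · exact le_trans (fun b hb => Subgroup.mem_centralizer_iff.2 fun a ha =>
        h.commute hij ha hb) le_sup_right
  exact htop (Subgroup.mem_top a)

/-- A simple factor is isomorphic to the quotient by its centralizer. -/
theorem isNonabelianSimple_quotient (h : IsInternalDirectProduct S) (i : ι)
    [(Subgroup.centralizer (S i : Set Q)).Normal] (hS : IsNonabelianSimple (S i)) :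
    IsNonabelianSimple (Q ⧸ Subgroup.centralizer (S i : Set Q)) := by
  have := hS.1
  let e : S i →* Q ⧸ Subgroup.centralizer (S i : Set Q) :=
    (QuotientGroup.mk' _).comp (S i).subtype
  have hinj : Function.Injective e := by
    rw [injective_iff_map_eq_one]
    intro s hs
    by_contra hs1
    obtain ⟨u, hu⟩ := exists_not_commute_of_ne_one hS.2 hs1
    have hsC : (s : Q) ∈ Subgroup.centralizer (S i : Set Q) := (QuotientGroup.eq_one_iff _).1 hs
    exact hu (Subtype.ext (Subgroup.mem_centralizer_iff.1 hsC u u.2))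
  have hsurj : Function.Surjective e := by
    intro t
    obtain ⟨a, rfl⟩ := QuotientGroup.mk_surjective t
    obtain ⟨s, hs, k, hk, rfl⟩ := h.exists_eq_mul i a
    exact ⟨⟨s, hs⟩, QuotientGroup.eq.2 (by simpa using hk)⟩
  let E := MulEquiv.ofBijective e ⟨hinj, hsurj⟩
  refine ⟨E.symm.isSimpleGroup, ?_⟩
  obtain ⟨a, b, hab⟩ := hS.2
  exact ⟨E a, E b, fun hE => hab (E.injective (by rw [map_mul, map_mul, hE]))⟩

theorem mem_center (h : IsInternalDirectProduct S) {a : Q}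
    (ha : ∀ i, a ∈ Subgroup.centralizer (S i : Set Q)) : a ∈ Subgroup.center Q := by
  have htop : (⊤ : Subgroup Q) ≤ Subgroup.centralizer {a} := by
    rw [← h.iSup_eq_top]
    exact iSup_le fun i b hb => Subgroup.mem_centralizer_singleton_iff.2
      (Subgroup.mem_centralizer_iff.1 (ha i) b hb)
  exact Subgroup.mem_center_iff.2 fun b =>
    Subgroup.mem_centralizer_singleton_iff.1 (htop (Subgroup.mem_top b))

end IsInternalDirectProduct

/-- The preimage of the center is a soluble normal subgroup, hence lies in the radical. -/
theorem center_quotient_solubleRadical (G : Type*) [Group G] [Finite G] :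
    Subgroup.center (G ⧸ solubleRadical G) = ⊥ := by
  have hsol := isSolvable_solubleRadical G
  let Z := (Subgroup.center (G ⧸ solubleRadical G)).comap (QuotientGroup.mk' (solubleRadical G))
  have hle : solubleRadical G ≤ Z := fun a ha => by
    rw [Subgroup.mem_comap, QuotientGroup.mk'_apply, (QuotientGroup.eq_one_iff a).2 ha]
    exact one_mem _
  have hZ : Group.IsSolvable Z := by
    let e : Z →* Subgroup.center (G ⧸ solubleRadical G) :=
      (QuotientGroup.mk' (solubleRadical G)).subgroupComap _
    have : Group.IsSolvable (Subgroup.center (G ⧸ solubleRadical G)) :=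
      Group.isSolvable_of_comm fun a b =>
        Subtype.ext (Subgroup.mem_center_iff.1 b.2 a)
    refine Group.isSolvable_of_ker_le_range (Subgroup.inclusion hle) e fun a ha => ?_
    have h1 : ((a : G) : G ⧸ solubleRadical G) = 1 := congrArg Subtype.val (MonoidHom.mem_ker.1 ha)
    exact ⟨⟨a, (QuotientGroup.eq_one_iff _).1 h1⟩, rfl⟩
  have hZR : Z ≤ solubleRadical G := le_sSup ⟨inferInstance, hZ⟩
  rw [Subgroup.eq_bot_iff_forall]
  intro a ha
  obtain ⟨a, rfl⟩ := QuotientGroup.mk_surjective a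
  exact (QuotientGroup.eq_one_iff a).2 (hZR ha)

section Radical

variable {A : Type*} [Group A] (G : Subgroup A)

/-- The soluble radical of `G`, as a subgroup of the ambient group. -/
abbrev ambientRadical : Subgroup A := (solubleRadical G).map G.subtype

variable {G}

theorem mk_eq_mk_ambientRadical_iff {a b : G} :
    (((a : A) : A ⧸ ambientRadical G) = ((b : A) : A ⧸ ambientRadical G)) ↔
      ((a : G ⧸ solubleRadical G) = (b : G ⧸ solubleRadical G)) := by
  rw [QuotientGroup.eq, QuotientGroup.eq]
  constructor
  · rintro ⟨c, hc, hcab⟩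
    have : c = a⁻¹ * b := Subtype.ext hcab
    exact this ▸ hc
  · intro hab
    exact ⟨a⁻¹ * b, hab, rfl⟩

open Classical in
/-- A function on `A` modulo the soluble radical of `G` extending the canonical map from `G` modulo
its radical to the quotient by `K`. -/
noncomputable def radicalProjection (K : Subgroup (G ⧸ solubleRadical G))
    (a : A ⧸ ambientRadical G) : (G ⧸ solubleRadical G) ⧸ K :=
  if h : ∃ b : G, ((b : A) : A ⧸ ambientRadical G) = a then
    ((h.choose : G ⧸ solubleRadical G) : (G ⧸ solubleRadical G) ⧸ K)
  -- The value outside the image of `G` is arbitrary: `IsFaithfulProjection` only evaluates the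
  -- function on that image.
  else ((1 : G ⧸ solubleRadical G) : (G ⧸ solubleRadical G) ⧸ K)

theorem radicalProjection_mk (K : Subgroup (G ⧸ solubleRadical G)) (a : G) :
    radicalProjection K ((a : A) : A ⧸ ambientRadical G) =
      ((a : G ⧸ solubleRadical G) : (G ⧸ solubleRadical G) ⧸ K) := by
  have h : ∃ b : G, ((b : A) : A ⧸ ambientRadical G) = ((a : A) : A ⧸ ambientRadical G) :=
    ⟨a, rfl⟩
  rw [radicalProjection, dif_pos h, mk_eq_mk_ambientRadical_iff.1 h.choose_spec]

variable [G.Normal]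

theorem conjModRadical_apply_mk (y : A) (a : G) :
    conjModRadical G y (a : G ⧸ solubleRadical G) =
      ((MulAut.conjNormal y a : G) : G ⧸ solubleRadical G) := rfl

theorem conjModRadical_eq_one_iff {y : A} :
    conjModRadical G y = 1 ↔ (y : A ⧸ ambientRadical G) ∈
      Subgroup.centralizer (G.map (QuotientGroup.mk' (ambientRadical G)) : Set _) := by
  have key : ∀ a : G, conjModRadical G y (a : G ⧸ solubleRadical G) = a ↔
      ((a : A) : A ⧸ ambientRadical G) * y = y * ((a : A) : A ⧸ ambientRadical G) := by
    intro a
    rw [conjModRadical_apply_mk, ← mk_eq_mk_ambientRadical_iff, MulAut.conjNormal_apply,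
      QuotientGroup.mk_mul, QuotientGroup.mk_mul, QuotientGroup.mk_inv, mul_inv_eq_iff_eq_mul]
    exact eq_comm
  rw [Subgroup.mem_centralizer_iff]
  constructor
  · rintro hy _ ⟨a, ha, rfl⟩
    exact (key ⟨a, ha⟩).1 (by rw [hy]; rfl)
  · intro hy
    ext a
    induction a using QuotientGroup.induction_on with
    | H a => exact (key a).2 (hy _ ⟨a, a.2, rfl⟩)

theorem radicalProjection_conj (K : Subgroup (G ⧸ solubleRadical G)) (y : A) (a : G) :
    radicalProjection K ((y : A ⧸ ambientRadical G) * ((a : A) : A ⧸ ambientRadical G) *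
      (y : A ⧸ ambientRadical G)⁻¹) =
      ((conjModRadical G y (a : G ⧸ solubleRadical G) : G ⧸ solubleRadical G) :
        (G ⧸ solubleRadical G) ⧸ K) := by
  rw [conjModRadical_apply_mk, ← radicalProjection_mk, MulAut.conjNormal_apply]
  rfl

/-- The projection of `G` modulo its radical onto one of the simple factors, which are permuted
transitively by `g`. -/
theorem isFaithfulProjection_radicalProjection [Finite A] {g : A} {ι : Type*}
    {S : ι → Subgroup (G ⧸ solubleRadical G)} (hprod : IsInternalDirectProduct S) (i₀ : ι)
    [(Subgroup.centralizer (S i₀ : Set (G ⧸ solubleRadical G))).Normal]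
    (htrans : MulAction.orbit (Subgroup.zpowers (conjModRadical G g)) (S i₀) = Set.range S) :
    IsFaithfulProjection (G.map (QuotientGroup.mk' (ambientRadical G)))
      (g : A ⧸ ambientRadical G)
      (radicalProjection (Subgroup.centralizer (S i₀ : Set (G ⧸ solubleRadical G)))) where
  conj_mem := by
    rintro _ ⟨n, rfl⟩ _ ⟨a, ha, rfl⟩
    exact ⟨g ^ n * a * (g ^ n)⁻¹, Subgroup.Normal.conj_mem ‹_› a ha _, rfl⟩
  map_mul := by
    rintro _ ⟨a, ha, rfl⟩ _ ⟨b, hb, rfl⟩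
    have h1 := radicalProjection_mk (Subgroup.centralizer (S i₀ : Set (G ⧸ solubleRadical G)))
      ⟨a, ha⟩
    have h2 := radicalProjection_mk (Subgroup.centralizer (S i₀ : Set (G ⧸ solubleRadical G)))
      ⟨b, hb⟩
    have h3 := radicalProjection_mk (Subgroup.centralizer (S i₀ : Set (G ⧸ solubleRadical G)))
      (⟨a, ha⟩ * ⟨b, hb⟩)
    rw [QuotientGroup.mk'_apply, QuotientGroup.mk'_apply, h1, h2]
    exact h3
  surj t := by
    obtain ⟨q, rfl⟩ := QuotientGroup.mk_surjective t
    obtain ⟨a, rfl⟩ := QuotientGroup.mk_surjective q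
    exact ⟨_, ⟨a, a.2, rfl⟩, radicalProjection_mk _ a⟩
  faithful := by
    rintro _ ⟨a, ha, rfl⟩ hy
    have h1 : ((⟨a, ha⟩ : G) : G ⧸ solubleRadical G) ∈ Subgroup.center (G ⧸ solubleRadical G) := by
      refine hprod.mem_center fun i => ?_
      -- By transitivity the `n`-th power of the induced automorphism carries `S i₀` to `S i`, so
      -- conjugation by `g ^ (-n)` reduces the claim to the centralizer of `S i₀`.
      obtain ⟨⟨_, n, rfl⟩, hn⟩ : S i ∈
          MulAction.orbit (Subgroup.zpowers (conjModRadical G g)) (S i₀) := htrans ▸ ⟨i, rfl⟩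
      have h2 := hy _ ⟨-n, rfl⟩
      have h3 := radicalProjection_conj
        (Subgroup.centralizer (S i₀ : Set (G ⧸ solubleRadical G))) (g ^ (-n)) ⟨a, ha⟩
      have h4 := h3.symm.trans h2
      rw [QuotientGroup.eq_one_iff] at h4
      refine Subgroup.mem_centralizer_iff.2 fun b hb => ?_
      have hb' : (conjModRadical G (g ^ (-n))) b ∈ S i₀ := by
        rw [SetLike.mem_coe, ← hn] at hb
        have := Subgroup.mem_pointwise_smul_iff_inv_smul_mem.1 hb
        rw [zpow_neg, map_inv, map_zpow]
        exact this
      have h5 := Subgroup.mem_centralizer_iff.1 h4 _ hb'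
      rw [← map_mul, ← map_mul] at h5
      exact (conjModRadical G (g ^ (-n))).injective h5
    rw [center_quotient_solubleRadical, Subgroup.mem_bot] at h1
    exact mk_eq_mk_ambientRadical_iff (a := ⟨a, ha⟩) (b := 1).2 h1

end Radical

/-! ### The theorem. -/

theorem mainTheorem5 {A : Type*} [Group A] [Finite A] (G : Subgroup A) [G.Normal] (g : A)
    (hA : G ⊔ Subgroup.zpowers g = ⊤)
    -- `G` is a minimal `g`-invariant subgroup covering `G/R`
    (h1 : Minimal (fun K : Subgroup G => IsInvariantUnder G g K ∧ CoversModRadical K) ⊤)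
    -- `G ∩ ⟨g⟩ ≤ C_{⟨g⟩}(G/R)`
    (h2 : G ⊓ Subgroup.zpowers g ≤ centralizerModRadical G g)
    -- `G/R = S_1 × ⋯ × S_r`, isomorphic nonabelian simple factors
    (r : ℕ) (S : Fin r → Subgroup (G ⧸ solubleRadical G))
    (hprod : IsInternalDirectProduct S)
    (hsimple : ∀ i, IsNonabelianSimple (S i))
    (hiso : ∀ i j, Nonempty (S i ≃* S j))
    -- the set of the factors is a single orbit of `⟨ḡ⟩`; `i₀` is the index of the factor `S_1`
    (i₀ : Fin r)
    (htrans : MulAction.orbit (Subgroup.zpowers (conjModRadical G g)) (S i₀) = Set.range S)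
    -- the stabilizer of `S_1` in `⟨ḡ⟩` is a `p`-group
    (p : ℕ) (hp : p.Prime)
    (h4 : IsPGroup p
      (MulAction.stabilizer (Subgroup.zpowers (conjModRadical G g)) (S i₀)))
    (H : Subgroup A) (hH : ¬ G ≤ H) :
    ∃ z ∈ G, (MulAut.conj z⁻¹ • H) ⊓ Subgroup.zpowers g ≤ centralizerModRadical G g := by
  have hSn := hprod.normal i₀
  have hproj := isFaithfulProjection_radicalProjection hprod i₀ htrans
  obtain ⟨hTs, hT⟩ := hprod.isNonabelianSimple_quotient i₀ (hsimple i₀)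
  suffices hsuff : ∃ z ∈ G, ∀ y ∈ Subgroup.zpowers g, z * y * z⁻¹ ∈ H →
      y ∈ (conjModRadical G).ker by
    obtain ⟨z, hz, hzH⟩ := hsuff
    refine ⟨z, hz, fun y hy => ⟨hy.2, hzH y hy.2 ?_⟩⟩
    simpa using Subgroup.mem_pointwise_smul_iff_inv_smul_mem.1 hy.1
  by_cases hHR : G ≤ H ⊔ ambientRadical G
  swap
  · obtain ⟨_, ⟨z, hz, rfl⟩, hzH⟩ := hproj.exists_conj_inf_zpowers_le hT hp _ (fun y hy => by
      obtain ⟨⟨n, rfl⟩, hy⟩ := hy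
      set y := g ^ n with hyn
      have hmem : conjModRadical G y ∈ Subgroup.zpowers (conjModRadical G g) :=
        ⟨n, (map_zpow _ _ _).symm⟩
      have hst : (⟨_, hmem⟩ : Subgroup.zpowers (conjModRadical G g)) • S i₀ = S i₀ := by
        -- If `y` moved `S i₀` to another factor, that factor would centralize `S i₀` and so lie in
        -- the kernel of the projection. As `y` preserves the kernel, `S i₀` would lie there too and
        -- be abelian.
        obtain ⟨j, hj⟩ : (⟨_, hmem⟩ : Subgroup.zpowers (conjModRadical G g)) • S i₀ ∈
            Set.range S := htrans ▸ ⟨_, rfl⟩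
        rw [← hj]
        by_contra hne
        have hij : i₀ ≠ j := fun h => hne (h ▸ rfl)
        obtain ⟨a, b, hab⟩ := (hsimple i₀).2
        apply hab
        have haj : conjModRadical G y a ∈ S j := by
          rw [hj]
          exact Subgroup.smul_mem_pointwise_smul (a : G ⧸ solubleRadical G) _ _ a.2
        obtain ⟨c, hc⟩ := QuotientGroup.mk_surjective (a : G ⧸ solubleRadical G)
        have h5 := hy _ ⟨c, c.2, rfl⟩ ((radicalProjection_conj _ y c).trans (by
          rw [QuotientGroup.eq_one_iff, hc]
          exact Subgroup.mem_centralizer_iff.2 fun b hb => hprod.commute hij hb haj))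
        have h6 := (radicalProjection_mk _ c).symm.trans h5
        rw [QuotientGroup.eq_one_iff, hc] at h6
        exact Subtype.ext (Subgroup.mem_centralizer_iff.1 h6 b b.2).symm
      obtain ⟨k, hk⟩ := h4 ⟨⟨_, hmem⟩, hst⟩
      refine ⟨k, ?_⟩
      have h5 : conjModRadical G y ^ p ^ k = 1 := congrArg
        (fun a : MulAction.stabilizer (Subgroup.zpowers (conjModRadical G g)) (S i₀) =>
          ((a : Subgroup.zpowers (conjModRadical G g)) : MulAut (G ⧸ solubleRadical G))) hk
      rw [← map_pow, conjModRadical_eq_one_iff] at h5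
      exact h5) (H.map (QuotientGroup.mk' (ambientRadical G))) (fun hle => hHR (by
        rw [Subgroup.map_le_iff_le_comap, QuotientGroup.comap_map_mk', sup_comm] at hle
        exact hle))
    refine ⟨z, hz, ?_⟩
    rintro _ ⟨n, rfl⟩ hy
    exact conjModRadical_eq_one_iff.2 (hzH _ ⟨n, rfl⟩ ⟨_, hy, rfl⟩)
  have hsol : Group.IsSolvable (ambientRadical G) := by
    have := isSolvable_solubleRadical G
    exact Group.isSolvable_of_surjective (G.subtype.subgroupMap_surjective (solubleRadical G))
  obtain ⟨F, x, hF, hdet⟩ := exists_primary_elements g (conjModRadical G).ker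
  obtain ⟨z, hz, hzx⟩ := exists_conj_notMem_of_le_sup_isSolvable G H (ambientRadical G) hHR hH F x
    (fun q hq => ⟨(hF q hq).1, (hF q hq).2.2.2.2⟩)
    (fun q hq q' hq' => Subgroup.mul_comm_of_mem_zpowers (hF q hq).2.1 (hF q' hq').2.1) (by
      intro L hL q hq
      obtain ⟨-, hxg, hxC, -⟩ := hF q hq
      by_contra! hcon
      -- Since `A = G⟨g⟩` and `⟨g⟩` centralizes `x q`, all `A`-conjugates of `x q` are in `L`. So
      -- the normal core of `L` contains `[G, x q]`, which is nontrivial modulo the radical; the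
      -- core therefore covers `G/R`, and minimality of `G` puts `G` inside `L`.
      have hconA : ∀ a : A, a * x q * a⁻¹ ∈ L := by
        intro a
        obtain ⟨b, hb, y, hy, rfl⟩ := Subgroup.mem_sup_of_normal_left.1
          (hA ▸ Subgroup.mem_top a : a ∈ G ⊔ Subgroup.zpowers g)
        have h5 : b * y * x q * (b * y)⁻¹ = b * x q * b⁻¹ := by
          rw [mul_assoc b, Subgroup.mul_comm_of_mem_zpowers hy hxg]; group
        exact h5 ▸ hcon b hb
      have hEn : (L.normalCore ⊓ G).Normal := inferInstance
      have hmem : ∀ z ∈ G, z * x q * z⁻¹ * (x q)⁻¹ ∈ L.normalCore ⊓ G := by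
        intro z hz
        refine ⟨fun a => ?_, ?_⟩
        · have := mul_mem (hconA (a * z)) (inv_mem (hconA a))
          simpa [mul_assoc] using this
        · have := mul_mem hz (Subgroup.Normal.conj_mem ‹G.Normal› _ (inv_mem hz) (x q))
          simpa [mul_assoc] using this
      have hle := hproj.le_of_invariant hT
        (E := (L.normalCore ⊓ G).map (QuotientGroup.mk' (ambientRadical G)))
        (Subgroup.map_mono inf_le_right)
        (by
          rintro _ ⟨a, ha, rfl⟩ _ ⟨e, he, rfl⟩
          exact ⟨a * e * a⁻¹, hEn.conj_mem e he a, rfl⟩)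
        (by
          rintro _ ⟨n, rfl⟩ _ ⟨e, he, rfl⟩
          exact ⟨g ^ n * e * (g ^ n)⁻¹, hEn.conj_mem e he _, rfl⟩)
        (by
          intro hbot
          apply hxC
          rw [MonoidHom.mem_ker, conjModRadical_eq_one_iff, Subgroup.mem_centralizer_iff]
          rintro _ ⟨z, hz, rfl⟩
          have h5 := (Subgroup.eq_bot_iff_forall _).1 hbot _ ⟨_, hmem z hz, rfl⟩
          rw [map_mul, map_mul, map_mul, map_inv, map_inv, mul_inv_eq_one,
            mul_inv_eq_iff_eq_mul] at h5
          exact h5)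
      have htop := h1.le_of_le (y := (L.normalCore ⊓ G).subgroupOf G)
        ⟨MulEquiv.map_eq_of_forall_mem (MulAut.conjNormal g) fun e he => by
          rw [Subgroup.mem_subgroupOf] at he ⊢
          rw [MulAut.conjNormal_apply]
          exact hEn.conj_mem e he g, by
          rw [CoversModRadical, eq_top_iff]
          intro t _
          obtain ⟨a, rfl⟩ := QuotientGroup.mk_surjective t
          obtain ⟨e, he, hea⟩ := hle ⟨a, a.2, rfl⟩
          exact ⟨⟨e, he.2⟩, Subgroup.mem_subgroupOf.2 he,
            mk_eq_mk_ambientRadical_iff (a := ⟨e, he.2⟩).1 hea⟩⟩ le_top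
      exact hL fun a ha =>
        L.normalCore_le (Subgroup.mem_subgroupOf.1 (htop (Subgroup.mem_top ⟨a, ha⟩))).1)
  refine ⟨z, Subgroup.map_subtype_le _ hz, fun y hy hyH => ?_⟩
  by_contra hyC
  obtain ⟨q, hq, hxy⟩ := hdet y hy hyC
  apply hzx q hq
  have : Subgroup.zpowers y ≤ H.comap (MulAut.conj z).toMonoidHom := by
    rw [Subgroup.zpowers_le]; simpa using hyH
  simpa using this hxy
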